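/- Let $\mathbb{D}\subset\mathbb{C}$ be the open unit disc, $\mathcal{H}(\mathbb{D})$ the space of holomorphic functions on $\mathbb{D}$ and $\tau_{\mathrm{co}}$ the compact-open topology (uniform convergence on compact sets). Let $\mathcal{F}(\mathbb{D})$ be a linear subspace of $\mathcal{H}(\mathbb{D})$ with a norm $\|\cdot\|$ such that $(\mathcal{F}(\mathbb{D}),\|\cdot\|,\tau_{\mathrm{co}})$ is a pre-Saks space, i.e. $\tau_{\mathrm{co}}$ is coarser on $\mathcal{F}(\mathbb{D})$ than the $\|\cdot\|$-topology. Let $\gamma=\gamma(\|\cdot\|,\tau_{\mathrm{co}})$ be the mixed topology: the finest linear topology on $\mathcal{F}(\mathbb{D})$ that is finer than $\tau_{\mathrm{co}}$, coarser than the $\|\cdot\|$-topology, and coincides with $\tau_{\mathrm{co}}$ on $\|\cdot\|$-bounded sets. Suppose that the pre-Saks space is sequentially complete, i.e. $(\mathcal{F}(\mathbb{D}),\gamma)$ is sequentially complete. Let $\mathcal{H}(\overline{\mathbb{D}})=\varinjlim_{\omega\supset\overline{\mathbb{D}}\text{ open}}(\mathcal{H}(\omega),\tau_{\mathrm{co}})$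 be the space of holomorphic germs near $\overline{\mathbb{D}}$ with its (locally convex) inductive limit topology, and suppose that $\mathcal{H}(\overline{\mathbb{D}})$ embeds continuously, by restriction to $\mathbb{D}$, into $(\mathcal{F}(\mathbb{D}),\|\cdot\|)$. Let $\mathbf{T}=(T(t))_{t\ge 0}$ be a $\gamma$-strongly continuous semigroup of linear maps on $\mathcal{F}(\mathbb{D})$, i.e. $T(0)=\mathrm{id}$, $T(t+s)=T(t)T(s)$ for all $t,s\ge 0$, each $T(t)$ is $\gamma$-continuous, and $t\mapsto T(t)f$ is $\gamma$-continuous on $[0,\infty)$ for every $f\in\mathcal{F}(\mathbb{D})$. Let $(A,D(A))$ be its generator, $Af=\gamma\text{-}\lim_{t\to0+}\frac{T(t)f-f}{t}$ with $D(A)$ the set of all $f\in\mathcal{F}(\mathbb{D})$ for which this limit exists in $\mathcal{F}(\mathbb{D})$. Suppose that for some $G,g\in\mathcal{H}(\mathbb{D})$ $$D(A)=\{f\in\mathcal{F}(\mathbb{D}) : Gf'+gf\in\mathcal{F}(\mathbb{D})\},\qquad Af=Gf'+gf\quad(f\in D(A)).$$ Then there are families $\varphi=(\varphi_t)_{t\ge0}$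 of holomorphic maps $\mathbb{D}\to\mathbb{D}$ and $m=(m_t)_{t\ge0}$ of holomorphic functions $\mathbb{D}\to\mathbb{C}$ such that: 1. $(m,\varphi)$ is a jointly continuous holomorphic co-semiflow on $\mathbb{D}$: $\varphi_0=\mathrm{id}$, $\varphi_{t+s}=\varphi_t\circ\varphi_s$, $m_0=1$, $m_{t+s}=m_t\cdot(m_s\circ\varphi_t)$ for all $t,s\ge 0$, and the maps $(t,z)\mapsto\varphi_t(z)$ and $(t,z)\mapsto m_t(z)$ are continuous on $[0,\infty)\times\mathbb{D}$; 2. $(m,\varphi)$ is a co-semiflow for $\mathcal{F}(\mathbb{D})$: $m_t\cdot(f\circ\varphi_t)\in\mathcal{F}(\mathbb{D})$ for all $t\ge 0$ and $f\in\mathcal{F}(\mathbb{D})$; 3. $G$ is the generator of $\varphi$: for every $z\in\mathbb{D}$ the map $t\mapsto\varphi_t(z)$ is continuously differentiable on $[0,\infty)$ (one-sided at $0$) with $\frac{d}{dt}\varphi_t(z)=G(\varphi_t(z))$ for all $t\ge0$; 4. $m_t(z)=\exp\left(\int_0^t g(\varphi_s(z))\,ds\right)$ for all $t\ge0$, $z\in\mathbb{D}$;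 5. $\mathbf{T}=(C_{m,\varphi}(t))_{t\ge0}$, i.e. $T(t)f=m_t\cdot(f\circ\varphi_t)$ for all $t\ge0$ and $f\in\mathcal{F}(\mathbb{D})$. -/

import Mathlib

open Set Filter Topology TopologicalSpace
open scoped NNReal

noncomputable section

namespace Saks

/-! ### Spaces of holomorphic functions -/

/-- Extension by zero of a function on an open set `U ⊆ ℂ`; it only serves to apply Mathlib's
notions of differentiability and derivative at the points of the open set `U`. -/
def extendZero (U : Opens ℂ) (f : U → ℂ) : ℂ → ℂ :=
  Function.extend (Subtype.val : U → ℂ) f 0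

/-- `f : U → ℂ` is holomorphic on the open set `U`. -/
def IsHolomorphic {U : Opens ℂ} (f : U → ℂ) : Prop :=
  DifferentiableOn ℂ (extendZero U f) (U : Set ℂ)

/-- The complex derivative `f' : U → ℂ` of a function `f : U → ℂ`. -/
def holDeriv {U : Opens ℂ} (f : U → ℂ) : U → ℂ :=
  fun z => deriv (extendZero U f) (z : ℂ)

theorem extendZero_apply {U : Opens ℂ} (f : U → ℂ) (z : U) : extendZero U f (z : ℂ) = f z :=
  Subtype.val_injective.extend_apply f 0 z

theorem extendZero_add {U : Opens ℂ} (f g : U → ℂ) :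
    extendZero U (f + g) = extendZero U f + extendZero U g := by
  have h := Function.extend_add (Subtype.val : U → ℂ) f g (0 : ℂ → ℂ) 0
  rw [add_zero] at h
  exact h

theorem extendZero_smul {U : Opens ℂ} (c : ℂ) (f : U → ℂ) :
    extendZero U (c • f) = c • extendZero U f := by
  have h := Function.extend_smul c (Subtype.val : U → ℂ) f (0 : ℂ → ℂ)
  rw [smul_zero] at h
  exact h

/-- The space `H(U)` of holomorphic functions on `U`, a subspace of `C(U, ℂ)`. -/
def Hol (U : Opens ℂ) : Submodule ℂ C(U, ℂ) where
  carrier := {f | IsHolomorphic (f : U → ℂ)}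
  add_mem' := by
    intro f g hf hg
    change DifferentiableOn ℂ (extendZero U ((f : U → ℂ) + g)) U
    rw [extendZero_add]
    exact DifferentiableOn.add hf hg
  zero_mem' := by
    have h : extendZero U ((0 : C(U, ℂ)) : U → ℂ) = fun _ => 0 := by
      have := extendZero_smul (U := U) 0 0
      rw [zero_smul, zero_smul] at this
      exact this
    change DifferentiableOn ℂ (extendZero U ((0 : C(U, ℂ)) : U → ℂ)) U
    rw [h]
    exact differentiableOn_const 0
  smul_mem' := by
    intro c f hf
    change DifferentiableOn ℂ (extendZero U (c • (f : U → ℂ))) U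
    rw [extendZero_smul]
    exact DifferentiableOn.const_smul hf c

/-- The compact-open topology on a space `F` of continuous functions on `U`. -/
abbrev coTopology {U : Opens ℂ} (F : Submodule ℂ C(U, ℂ)) : TopologicalSpace F :=
  TopologicalSpace.induced (Subtype.val : F → C(U, ℂ)) ContinuousMap.compactOpen

/-- The open unit disc. -/
def disc : Opens ℂ := ⟨Metric.ball 0 1, Metric.isOpen_ball⟩

/-- The closed unit disc. -/
def closedDisc : Set ℂ := Metric.closedBall 0 1

/-! ### Holomorphic germs near the closed unit disc -/

/-- The space of germs along the closed unit disc (of functions defined near it) that have a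
representative which is holomorphic on some open set containing the closed unit disc. -/
def HolGerm : Submodule ℂ ((𝓝ˢ closedDisc).Germ ℂ) where
  carrier := {q | ∃ ω : Opens ℂ, closedDisc ⊆ ω ∧
    ∃ f : ℂ → ℂ, DifferentiableOn ℂ f ω ∧ q = (f : (𝓝ˢ closedDisc).Germ ℂ)}
  add_mem' := by
    rintro _ _ ⟨ω₁, h₁, f₁, hf₁, rfl⟩ ⟨ω₂, h₂, f₂, hf₂, rfl⟩
    exact ⟨ω₁ ⊓ ω₂, subset_inter h₁ h₂, f₁ + f₂,
      (hf₁.mono inter_subset_left).add (hf₂.mono inter_subset_right), rfl⟩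
  zero_mem' := ⟨⊤, subset_univ _, 0, differentiableOn_const 0, rfl⟩
  smul_mem' := by
    rintro c _ ⟨ω, h, f, hf, rfl⟩
    exact ⟨ω, h, c • f, hf.const_smul c, rfl⟩

/-- The canonical map `H(ω) → H(closed disc)` sending a function to its germ. -/
def germOf (ω : Opens ℂ) (hω : closedDisc ⊆ ω) (f : Hol ω) : HolGerm :=
  ⟨(extendZero ω (f : C(ω, ℂ)) : (𝓝ˢ closedDisc).Germ ℂ),
    ω, hω, extendZero ω (f : C(ω, ℂ)), f.2, rfl⟩

/-- The inductive limit topology on the space of germs: the finest locally convex topology for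
which all canonical maps `H(ω) → H(closed disc)`, `ω` an open neighbourhood of the closed disc and
`H(ω)` with the compact-open topology, are continuous. (In Mathlib's order on topologies `σ ≤ σ'`
means that `σ` is finer than `σ'`.) -/
abbrev germTopology : TopologicalSpace HolGerm :=
  sInf {σ | @IsTopologicalAddGroup HolGerm σ _ ∧ @ContinuousSMul ℂ HolGerm _ _ σ ∧
    @LocallyConvexSpace ℝ HolGerm _ _ _ _ σ ∧
    ∀ (ω : Opens ℂ) (hω : closedDisc ⊆ ω), Continuous[coTopology (Hol ω), σ] (germOf ω hω)}

/-! ### Pre-Saks spaces and the mixed topology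

A triple `(X, p, τ)` consists of a complex vector space `X`, a norm `p` on `X` (a definite
seminorm) and a topology `τ` on `X`. -/

section Mixed

variable {X : Type*} [AddCommGroup X] [Module ℂ X]

/-- The topology defined by the (semi)norm `p`. -/
abbrev normTopology (p : Seminorm ℂ X) : TopologicalSpace X :=
  p.toAddGroupSeminorm.toSeminormedAddCommGroup.toPseudoMetricSpace.toUniformSpace.toTopologicalSpace

/-- `(X, p, τ)` is a pre-Saks space: `p` is a norm on `X`, and `τ` is a Hausdorff locally convex
topology on `X` that is coarser than the norm topology. -/
structure IsPreSaks (p : Seminorm ℂ X) (τ : TopologicalSpace X) : Prop where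
  definite : ∀ x, p x = 0 → x = 0
  addGroup : @IsTopologicalAddGroup X τ _
  smul : @ContinuousSMul ℂ X _ _ τ
  locallyConvex : @LocallyConvexSpace ℝ X _ _ _ _ τ
  hausdorff : @T2Space X τ
  coarser : normTopology p ≤ τ

/-- `σ` is a linear topology on `X` with `τ ⊆ σ ⊆ τ_p` that coincides with `τ` on `p`-bounded
sets. -/
structure IsMixing (p : Seminorm ℂ X) (τ σ : TopologicalSpace X) : Prop where
  addGroup : @IsTopologicalAddGroup X σ _
  smul : @ContinuousSMul ℂ X _ _ σ
  coarser : normTopology p ≤ σ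
  finer : σ ≤ τ
  coincide : ∀ B : Set X, (∃ C : ℝ, ∀ x ∈ B, p x ≤ C) →
    σ.induced (Subtype.val : B → X) = τ.induced (Subtype.val : B → X)

/-- The mixed topology `γ(p, τ)`: the finest linear topology between `τ` and the norm topology
that coincides with `τ` on `p`-bounded sets. -/
abbrev mixedTopology (p : Seminorm ℂ X) (τ : TopologicalSpace X) : TopologicalSpace X :=
  sInf {σ | IsMixing p τ σ}

/-- In a pre-Saks space the mixed topology itself is one of the topologies of which it is the
finest. -/
theorem IsPreSaks.isMixing_mixedTopology {p : Seminorm ℂ X} {τ : TopologicalSpace X}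
    (h : IsPreSaks p τ) : IsMixing p τ (mixedTopology p τ) := by
  have hτ : IsMixing p τ τ := ⟨h.addGroup, h.smul, h.coarser, le_rfl, fun _ _ => rfl⟩
  refine ⟨topologicalAddGroup_sInf fun σ hσ => hσ.addGroup,
    continuousSMul_sInf fun σ hσ => hσ.smul, le_sInf fun σ hσ => hσ.coarser, sInf_le hτ,
    fun B hB => le_antisymm (induced_mono (sInf_le hτ)) ?_⟩
  rw [mixedTopology, sInf_eq_iInf, induced_iInf]
  refine le_iInf fun σ => ?_
  rw [induced_iInf]
  exact le_iInf fun hσ => (hσ.coincide B hB).ge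

/-- Sequential completeness of `X` with respect to a linear topology `σ`. -/
def IsSeqComplete (σ : TopologicalSpace X) : Prop :=
  ∀ u : ℕ → X, Tendsto (fun k : ℕ × ℕ => u k.1 - u k.2) atTop (@nhds X σ 0) →
    ∃ x, Tendsto u atTop (@nhds X σ x)

/-- `(T(t))_{t ≥ 0}` is a `σ`-strongly continuous semigroup of linear maps: it is a semigroup,
every `T(t)` is `σ`-continuous, and all orbits are `σ`-continuous. -/
structure IsStronglyContSemigroup (σ : TopologicalSpace X) (T : ℝ≥0 → X →ₗ[ℂ] X) : Prop where
  zero : T 0 = LinearMap.id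
  add : ∀ t s, T (t + s) = T t ∘ₗ T s
  cont : ∀ t, Continuous[σ, σ] (T t)
  orbit : ∀ x, Continuous[(inferInstance : TopologicalSpace ℝ≥0), σ] (fun t => T t x)

/-- `x ∈ D(A)` and `A x = y` for the generator `(A, D(A))` of `T` with respect to `σ`, i.e.
`(T(t)x - x) / t → y` in `σ` as `t → 0+`. -/
def HasGeneratorValue (σ : TopologicalSpace X) (T : ℝ≥0 → X →ₗ[ℂ] X) (x y : X) : Prop :=
  Tendsto (fun t : ℝ≥0 => ((t : ℝ) : ℂ)⁻¹ • (T t x - x)) (𝓝[>] 0) (@nhds X σ y)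

/-- The domain `D(A)` of the generator of `T` with respect to `σ`. -/
def generatorDomain (σ : TopologicalSpace X) (T : ℝ≥0 → X →ₗ[ℂ] X) : Set X :=
  {x | ∃ y, HasGeneratorValue σ T x y}

end Mixed

/-- The germs embed continuously into the space `F` of functions on the disc with norm `p`: for
every germ `q` the restriction of `q` to the disc belongs to `F`, and the resulting linear map from
the germs (with the inductive limit topology) to `(F, p)` is continuous. (It is automatically
injective.) -/
def GermsEmbedContinuously (F : Submodule ℂ C(disc, ℂ)) (p : Seminorm ℂ F) : Prop :=
  ∃ J : HolGerm →ₗ[ℂ] F,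
    (∀ (q : HolGerm) (f : ℂ → ℂ), (q : (𝓝ˢ closedDisc).Germ ℂ) = f →
      ∀ z : disc, (J q : C(disc, ℂ)) z = f z) ∧
    Continuous[germTopology, normTopology p] J

/-- The mixed topology `γ(p, τ_co)` of a space `F` of functions on the disc with norm `p`, where
`τ_co` is the compact-open topology. -/
abbrev gammaTopology (F : Submodule ℂ C(disc, ℂ)) (p : Seminorm ℂ F) : TopologicalSpace F :=
  mixedTopology p (coTopology F)

/-! ### Semiflows and semicocycles -/

section Flow

variable {Ω : Type*} [TopologicalSpace Ω]

/-- `φ` is a semiflow on `Ω`. -/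
structure IsSemiflow (φ : ℝ≥0 → Ω → Ω) : Prop where
  cont : ∀ t, Continuous (φ t)
  zero : ∀ x, φ 0 x = x
  add : ∀ t s x, φ (t + s) x = φ t (φ s x)

/-- `m` is a (multiplicative) semicocycle for `φ`. -/
structure IsSemicocycle (φ : ℝ≥0 → Ω → Ω) (m : ℝ≥0 → Ω → ℂ) : Prop where
  cont : ∀ t, Continuous (m t)
  zero : ∀ x, m 0 x = 1
  add : ∀ t s x, m (t + s) x = m t x * m s (φ t x)

/-- A family of maps indexed by `t ≥ 0` is jointly continuous. -/
def JointlyContinuous {Y : Type*} [TopologicalSpace Y] (φ : ℝ≥0 → Ω → Y) : Prop :=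
  Continuous fun q : ℝ≥0 × Ω => φ q.1 q.2

end Flow

/-- `(m, φ)` is a jointly continuous holomorphic co-semiflow on the open set `U`. -/
structure IsJointlyContHolCoSemiflow {U : Opens ℂ} (m : ℝ≥0 → U → ℂ) (φ : ℝ≥0 → U → U) :
    Prop where
  semiflow : IsSemiflow φ
  semicocycle : IsSemicocycle φ m
  joint_flow : JointlyContinuous φ
  joint_cocycle : JointlyContinuous m
  hol_flow : ∀ t, IsHolomorphic fun z => (φ t z : ℂ)
  hol_cocycle : ∀ t, IsHolomorphic (m t)

/-- `(m, φ)` is a co-semiflow for the function space `F`: `m_t · (f ∘ φ_t) ∈ F` for all `t ≥ 0`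
and `f ∈ F`. -/
def IsCoSemiflowFor {U : Opens ℂ} (F : Submodule ℂ C(U, ℂ)) (m : ℝ≥0 → U → ℂ)
    (φ : ℝ≥0 → U → U) : Prop :=
  ∀ (t : ℝ≥0) (f : F), ∃ h : F, ∀ z : U, (h : C(U, ℂ)) z = m t z * (f : C(U, ℂ)) (φ t z)

/-- `G` is the generator of the semiflow `φ` on `U`: `G` is continuous, every orbit is of class
`C¹` on `[0, ∞)`, and `(d/dt) φ_t(z) = G(φ_t(z))` for `t ≥ 0`, one-sided at `t = 0`. -/
structure IsFlowGenerator {U : Opens ℂ} (φ : ℝ≥0 → U → U) (G : U → ℂ) : Prop where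
  cont : Continuous G
  contDiff : ∀ z, ContDiffOn ℝ 1 (fun s : ℝ => (φ s.toNNReal z : ℂ)) (Ici 0)
  deriv_eq : ∀ (t : ℝ≥0) (z : U),
    HasDerivWithinAt (fun s : ℝ => (φ s.toNNReal z : ℂ)) (G (φ t z)) (Ici 0) (t : ℝ)

end Saks

end

noncomputable section

namespace Saks

/-! ### Local convexity of the mixed topology. -/

section LocalConvexity

open scoped Pointwise

variable {X : Type*} [AddCommGroup X] [Module ℂ X]

/-! For `f` in `D(A)` the function `u(t, z) = (T(t)f)(z)` solves the transport equation `u_t = G u_z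
+ g u`. Hence along a curve with `w' = G(w)` the quantity `exp(∫₀ˢ g(w)) (T(a-s)f)(w(s))` does not
depend on `s`, and comparing `s = 0` with `s = a` gives `(T(a)f)(w(0)) = exp(∫₀ᵃ g(w)) f(w(a))`.
Evaluations are γ-continuous and `D(A)` is γ-dense, so this formula holds on all of `F`
(`apply_eq_of_isSolution`). Density comes from the Riemann means of orbits. They converge by
sequential completeness once γ is known to be locally convex, which needs proof because γ is the
finest linear topology of its kind.

The main point is that the characteristics never leave the disc (`exists_isSolution_of_apply_eq`).
Solutions starting in `|y| ≤ 1/2` live up to a common time `ε`. For `s ≤ ε` put `m = T(s)1` and `q =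
T(s)id`; where the solution survives until `s`, its endpoint is `q/m`. For `|b| > 1` the function
`1/(b-z)` lies in `F`, and the formula near 0 gives `T(s)[1/(b-z)] (b m - q) = m²`, which the
identity theorem spreads over the disc. So `q = b m` forces `m = 0`, and `q/m` extends to a
holomorphic map into the closed disc. Its value at 0 is bounded by some `ρ < 1` uniformly in `s ≤
ε`, so Schwarz–Pick confines the solution from any `x` to a compact set independent of `s`. Every
solution therefore lives up to `ε`, and `ε` does not depend on `x`, so all solutions are global.

Finally `m_t = T(t)1` and `φ_t = T(t)id / T(t)1` inherit holomorphy, joint continuity and the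
algebraic laws from `T`. -/

theorem exists_convex_balanced_nhds {τ : TopologicalSpace X}
    (h₁ : @ContinuousSMul ℂ X _ _ τ) (h₂ : @LocallyConvexSpace ℝ X _ _ _ _ τ) {W : Set X}
    (hW : W ∈ @nhds X τ 0) :
    ∃ V ∈ @nhds X τ 0, Convex ℝ V ∧ Balanced ℂ V ∧ V ⊆ W := by
  let := τ
  have := h₁
  have := h₂
  obtain ⟨s, ⟨hs, hsc⟩, hsW⟩ := (LocallyConvexSpace.convex_basis_zero ℝ X).mem_iff.1 hW
  -- This set is balanced by construction, inherits convexity from `s`, and is a neighbourhood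
  -- because it contains the balanced core of `s`.
  refine ⟨{x | ∀ c : ℂ, ‖c‖ ≤ 1 → c • x ∈ s}, ?_, ?_, ?_, ?_⟩
  · refine mem_of_superset (balancedCore_mem_nhds_zero (𝕜 := ℂ) hs) fun x hx c hc => ?_
    exact balancedCore_subset s ((balancedCore_balanced s).smul_mem hc hx)
  · intro x hx y hy a b ha hb hab c hc
    have := hsc (hx c hc) (hy c hc) ha hb hab
    rwa [smul_comm a c x, smul_comm b c y, ← smul_add] at this
  · rintro a ha _ ⟨x, hx, rfl⟩ c hc
    change c • a • x ∈ s
    rw [smul_smul]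
    exact hx _ (by rw [norm_mul]; exact mul_le_one₀ hc (norm_nonneg _) ha)
  · intro x hx
    simpa using hsW (by simpa using hx 1 (by simp))

theorem mem_nhds_normTopology {q : Seminorm ℂ X} {x : X} {s : Set X} :
    s ∈ @nhds X (normTopology q) x ↔ ∃ ε > 0, ∀ y, q (y - x) < ε → y ∈ s := by
  let := q.toAddGroupSeminorm.toSeminormedAddCommGroup
  have hd : ∀ y : X, dist y x = q (y - x) := fun y => dist_eq_norm y x
  rw [Metric.mem_nhds_iff]
  simp only [subset_def, Metric.mem_ball, hd]

theorem le_normTopology {ρ : TopologicalSpace X} (h : @IsTopologicalAddGroup X ρ _)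
    {q : Seminorm ℂ X} (hq : ∀ ε > 0, {x | q x < ε} ∈ @nhds X ρ 0) : ρ ≤ normTopology q := by
  let := ρ
  have := h
  refine le_of_nhds_le_nhds fun x s hs => ?_
  obtain ⟨ε, hε, hs⟩ := mem_nhds_normTopology.1 hs
  have : Tendsto (fun y => y - x) (𝓝 x) (𝓝 0) := by
    simpa using (tendsto_id (α := X) (x := 𝓝 x)).sub_const x
  filter_upwards [this (hq ε hε)] with y hy
  exact hs y hy

/-- A seminorm whose restrictions to norm-bounded sets are `τ`-continuous at the origin is
continuous for the mixed topology. -/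
theorem IsPreSaks.mixedTopology_le_normTopology {p : Seminorm ℂ X} {τ : TopologicalSpace X}
    (h : IsPreSaks p τ) {q : Seminorm ℂ X}
    (hq : ∀ C : ℝ, ∀ ε > 0, ∃ V ∈ @nhds X τ 0, ∀ x ∈ V, p x ≤ C → q x < ε) :
    mixedTopology p τ ≤ normTopology q := by
  have hN : @IsTopologicalAddGroup X (normTopology q) _ := by
    let := q.toAddGroupSeminorm.toSeminormedAddCommGroup
    infer_instance
  have hS : @ContinuousSMul ℂ X _ _ (normTopology q) := by
    let := q.toAddGroupSeminorm.toSeminormedAddCommGroup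
    let : NormedSpace ℂ X := ⟨fun a b => (map_smul_eq_mul q a b).le⟩
    infer_instance
  have hNp : @IsTopologicalAddGroup X (normTopology p) _ := by
    let := p.toAddGroupSeminorm.toSeminormedAddCommGroup
    infer_instance
  -- The mixed topology is finer than every competitor, so it suffices that `τ` refined by `q` is
  -- one.
  suffices hmix : IsMixing p τ (τ ⊓ normTopology q) from (sInf_le hmix).trans inf_le_right
  refine ⟨@topologicalAddGroup_inf _ _ _ _ h.addGroup hN,
    @continuousSMul_inf _ _ _ _ _ _ h.smul hS, le_inf h.coarser ?_, inf_le_left, ?_⟩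
  · refine le_normTopology hNp fun ε hε => ?_
    obtain ⟨V, hV, hVq⟩ := hq 1 ε hε
    have hV' := nhds_mono h.coarser hV
    obtain ⟨δ, hδ, hV'⟩ := mem_nhds_normTopology.1 hV'
    refine mem_nhds_normTopology.2 ⟨min δ 1, by positivity, fun y hy => ?_⟩
    exact hVq y (hV' y (hy.trans_le (min_le_left _ _)))
      (by simpa using (hy.trans_le (min_le_right _ _)).le)
  · rintro B ⟨C, hC⟩
    rw [induced_inf, inf_eq_left]
    refine le_of_nhds_le_nhds fun x s hs => ?_
    obtain ⟨t, ht, hts⟩ := (@mem_nhds_induced _ _ (normTopology q) _ x s).1 hs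
    obtain ⟨ε, hε, ht⟩ := mem_nhds_normTopology.1 ht
    -- Differences of two points of `B` have `p` at most `C + C`.
    obtain ⟨V, hV, hVq⟩ := hq (C + C) ε hε
    let := τ
    have := h.addGroup
    have : Tendsto (fun y => y - (x : X)) (𝓝 (x : X)) (𝓝 0) := by
      simpa using (tendsto_id (α := X) (x := 𝓝 (x : X))).sub_const (x : X)
    refine (mem_nhds_induced _ x s).2 ⟨_, this hV, fun y hy => hts (ht _ (hVq _ hy ?_))⟩
    exact (map_sub_le_add p _ _).trans (add_le_add (hC _ y.2) (hC _ x.2))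

/-- The mixed topology of a pre-Saks space is locally convex. -/
theorem IsPreSaks.exists_convex_nhds {p : Seminorm ℂ X} {τ : TopologicalSpace X}
    (h : IsPreSaks p τ) {W : Set X} (hW : W ∈ @nhds X (mixedTopology p τ) 0) :
    ∃ U ∈ @nhds X (mixedTopology p τ) 0, Convex ℝ U ∧ U ⊆ W := by
  have hmix := h.isMixing_mixedTopology
  have hhalf : ∀ s : {s // s ∈ @nhds X (mixedTopology p τ) 0},
      ∃ t : {s // s ∈ @nhds X (mixedTopology p τ) 0}, (t : Set X) + t ⊆ s := by
    intro s
    let := mixedTopology p τ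
    have := hmix.addGroup
    obtain ⟨V, hV, hVs⟩ := exists_nhds_zero_half s.2
    refine ⟨⟨V, hV⟩, ?_⟩
    rintro _ ⟨a, ha, b, hb, rfl⟩
    exact hVs a ha b hb
  choose half hhalf using hhalf
  -- Successive halving: a sum of one element from each of `Ws 1, …, Ws n` stays in `W`.
  let Ws : ℕ → {s // s ∈ @nhds X (mixedTopology p τ) 0} := fun n => half^[n] ⟨W, hW⟩
  have hWs : ∀ n, (Ws (n + 1) : Set X) + Ws (n + 1) ⊆ Ws n := by
    intro n
    simp only [Ws, Function.iterate_succ_apply']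
    exact hhalf _
  have hV : ∀ n : ℕ, ∃ V ∈ @nhds X τ 0, Convex ℝ V ∧ Balanced ℂ V ∧
      ∀ x ∈ V, p x ≤ n + 1 → x ∈ (Ws (n + 1) : Set X) := by
    intro n
    have hco := hmix.coincide {x | p x ≤ n + 1} ⟨n + 1, fun x hx => hx⟩
    let o : {x | p x ≤ (n : ℝ) + 1} := ⟨0, by simp; positivity⟩
    have hcomap : comap (Subtype.val : {x | p x ≤ (n : ℝ) + 1} → X)
        (@nhds X (mixedTopology p τ) 0) = comap Subtype.val (@nhds X τ 0) := by
      have h₁ := @nhds_induced _ _ (mixedTopology p τ) (Subtype.val : {x | p x ≤ (n : ℝ) + 1} → X) o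
      have h₂ := @nhds_induced _ _ τ (Subtype.val : {x | p x ≤ (n : ℝ) + 1} → X) o
      rw [hco] at h₁
      exact h₁.symm.trans h₂
    have hmem := preimage_mem_comap (m := (Subtype.val : {x | p x ≤ (n : ℝ) + 1} → X))
      (Ws (n + 1)).2
    rw [hcomap] at hmem
    obtain ⟨V, hV, hVW⟩ := mem_comap.1 hmem
    obtain ⟨V', hV', hc, hb, hV'V⟩ := exists_convex_balanced_nhds h.smul h.locallyConvex hV
    exact ⟨V', hV', hc, hb, fun x hx hpx => @hVW ⟨x, hpx⟩ (hV'V hx)⟩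
  choose V hV hVc hVb hVW using hV
  let C : ℕ → Set X := fun n => V n ∩ {x | p x ≤ n + 1}
  have hC0 : ∀ n, (0 : X) ∈ C n := fun n =>
    ⟨mem_of_mem_nhds (hV n), by simp; positivity⟩
  have hCc : ∀ n, Convex ℝ (C n) := fun n => (hVc n).inter (by
    have := p.convex_closedBall 0 ((n : ℝ) + 1)
    rw [Seminorm.closedBall_zero_eq] at this
    exact this)
  have hCb : ∀ n, Balanced ℂ (C n) := fun n => (hVb n).inter (by
    have := p.balanced_closedBall_zero ((n : ℝ) + 1)
    rw [Seminorm.closedBall_zero_eq] at this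
    exact this)
  -- `S n = C 0 + … + C (n - 1)`. The union of these sets is convex, balanced and contained in `W`;
  -- its gauge will be continuous for the mixed topology.
  let S : ℕ → Set X := fun n => Nat.rec {0} (fun k s => s + C k) n
  have hS : ∀ n, S (n + 1) = S n + C n := fun n => rfl
  have hSmono : Monotone S := monotone_nat_of_le_succ fun n x hx =>
    ⟨x, hx, 0, hC0 n, add_zero x⟩
  have hSc : ∀ n, Convex ℝ (S n) := by
    intro n
    induction n with
    | zero => exact convex_singleton 0
    | succ n ih => exact ih.add (hCc n)
  have hSb : ∀ n, Balanced ℂ (S n) := by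
    intro n
    induction n with
    | zero => exact balanced_zero
    | succ n ih => exact ih.add (hCb n)
  have hS0 : ∀ n, (0 : X) ∈ S n := fun n => hSmono (Nat.zero_le n) rfl
  have hSW : ∀ n, S n + (Ws n : Set X) ⊆ W := by
    intro n
    induction n with
    | zero =>
      rintro _ ⟨a, rfl, b, hb, rfl⟩
      simpa [Ws] using hb
    | succ n ih =>
      rintro _ ⟨_, ⟨a, ha, c, hc, rfl⟩, b, hb, rfl⟩
      refine ih ⟨a, ha, c + b, hWs n ⟨c, hVW n c hc.1 hc.2, b, hb, rfl⟩, ?_⟩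
      exact (add_assoc a c b).symm
  let U : Set X := ⋃ n, S n
  have hUW : U ⊆ W := iUnion_subset fun n x hx =>
    hSW n ⟨x, hx, 0, @mem_of_mem_nhds X (mixedTopology p τ) _ _ (Ws n).2, add_zero x⟩
  have hUc : Convex ℝ U := (hSmono.directed_le).convex_iUnion hSc
  have hUb : Balanced ℂ U := balanced_iUnion hSb
  have hU0 : (0 : X) ∈ U := mem_iUnion.2 ⟨0, rfl⟩
  have hCU : ∀ n, C n ⊆ U := fun n x hx =>
    mem_iUnion.2 ⟨n + 1, 0, hS0 n, x, hx, zero_add x⟩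
  -- Scaling by `1/ε` sends the `p`-ball of radius `K` into that of radius `n + 1` as soon as `n ≥
  -- K/ε`, so `C n` can be used. This yields both absorbency and the criterion for the gauge.
  have hsmall : ∀ K : ℝ, ∀ ε : ℝ, 0 < ε → ∃ V' ∈ @nhds X τ 0, ∀ x ∈ V', p x ≤ K →
      x ∈ ε • U := by
    intro K ε hε
    obtain ⟨n, hn⟩ := exists_nat_ge (K / ε)
    let := τ
    have := h.smul
    have hε' : ((ε : ℝ) : ℂ)⁻¹ ≠ 0 := by simpa using hε.ne'
    have : Tendsto (fun x : X => ((ε : ℝ) : ℂ)⁻¹ • x) (𝓝 0) (𝓝 0) := by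
      simpa using (tendsto_id (α := X) (x := 𝓝 (0 : X))).const_smul ((ε : ℝ) : ℂ)⁻¹
    refine ⟨_, this (hV n), fun x hx hpx => ?_⟩
    refine ⟨((ε : ℝ) : ℂ)⁻¹ • x, hCU n ⟨hx, ?_⟩, ?_⟩
    · have : p (((ε : ℝ) : ℂ)⁻¹ • x) = p x / ε := by
        rw [map_smul_eq_mul, norm_inv, Complex.norm_real, Real.norm_of_nonneg hε.le]
        field_simp
      change p _ ≤ _
      rw [this]
      exact ((div_le_div_iff_of_pos_right hε).2 hpx).trans (by linarith)
    · change ε • ((ε : ℝ) : ℂ)⁻¹ • x = x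
      rw [← Complex.coe_smul ε, smul_smul, mul_inv_cancel₀ (by simpa using hε.ne'), one_smul]
  have hUa : Absorbent ℝ U := by
    refine absorbent_iff_eventually_nhdsNE_zero.2 fun x => ?_
    let := τ
    have := h.smul
    obtain ⟨V', hV', hx⟩ := hsmall (p x) 1 one_pos
    have ht : Tendsto (fun t : ℝ => ((t : ℝ) : ℂ) • x) (𝓝 0) (𝓝 0) := by
      have : Continuous fun t : ℝ => ((t : ℝ) : ℂ) • x := by fun_prop
      simpa using this.tendsto 0
    filter_upwards [nhdsWithin_le_nhds (ht hV'),
      nhdsWithin_le_nhds (Metric.closedBall_mem_nhds (0 : ℝ) one_pos)] with t htV ht1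
    have hp : p ((t : ℂ) • x) ≤ p x := by
      rw [map_smul_eq_mul, Complex.norm_real]
      exact mul_le_of_le_one_left (apply_nonneg p x) (by simpa using ht1)
    simpa using hx _ htV hp
  let q : Seminorm ℂ X := gaugeSeminorm hUb hUc hUa
  have hle := h.mixedTopology_le_normTopology (q := q) fun K ε hε => by
    obtain ⟨V', hV', hx⟩ := hsmall K (ε / 2) (half_pos hε)
    exact ⟨V', hV', fun x hxV hpx =>
      (gauge_le_of_mem (half_pos hε).le (hx x hxV hpx)).trans_lt (half_lt_self hε)⟩
  refine ⟨{x | q x < 1}, nhds_mono hle (mem_nhds_normTopology.2 ⟨1, one_pos, by simp⟩), ?_, ?_⟩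
  · have := q.convex_ball 0 1
    rwa [Seminorm.ball_zero_eq] at this
  · exact (setOfPred_gauge_lt_one_subset_self hUc hU0 hUa).trans hUW

end LocalConvexity

/-! ### Riemann means of orbits and density of the generator domain. -/

section Average

/-- The Riemann sum, divided by `t`, of `c` on `[0, t]` for the subdivision into `n + 1` equal
parts. -/
def average {X : Type*} [AddCommGroup X] [Module ℝ X] (c : ℝ≥0 → X) (t : ℝ≥0) (n : ℕ) : X :=
  ((n : ℝ) + 1)⁻¹ • ∑ i ∈ Finset.range (n + 1), c (t * i / (n + 1))

theorem map_average {X Y : Type*} [AddCommGroup X] [Module ℂ X] [AddCommGroup Y] [Module ℂ Y]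
    (L : X →ₗ[ℂ] Y) (c : ℝ≥0 → X) (t : ℝ≥0) (n : ℕ) :
    L (average c t n) = average (fun s => L (c s)) t n := by
  rw [average, average, ← map_sum]
  exact (L.restrictScalars ℝ).map_smul _ _

theorem inv_smul_sum_range_mem {X : Type*} [AddCommGroup X] [Module ℝ X] {U : Set X}
    (hU : Convex ℝ U) {n : ℕ} {f : ℕ → X} (hf : ∀ i < n + 1, f i ∈ U) :
    ((n : ℝ) + 1)⁻¹ • ∑ i ∈ Finset.range (n + 1), f i ∈ U := by
  rw [Finset.smul_sum]
  refine hU.sum_mem (fun _ _ => by positivity) ?_ fun i hi => hf i (Finset.mem_range.1 hi)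
  simp
  field_simp

theorem sum_range_mul_eq {X : Type*} [AddCommMonoid X] (f : ℕ → X) (a b : ℕ) :
    ∑ i ∈ Finset.range (a * b), f i =
      ∑ i ∈ Finset.range a, ∑ j ∈ Finset.range b, f (i * b + j) := by
  induction a with
  | zero => simp
  | succ a ih => rw [Nat.succ_mul, Finset.sum_range_add, ih, Finset.sum_range_succ]

theorem mesh_lt {t : ℝ≥0} {δ : ℝ} (hδ : 0 < δ) :
    ∃ n₀ : ℕ, ∀ n ≥ n₀, (t : ℝ) / (n + 1) < δ := by
  obtain ⟨n₀, hn₀⟩ := exists_nat_gt ((t : ℝ) / δ)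
  refine ⟨n₀, fun n hn => ?_⟩
  have : (n₀ : ℝ) ≤ n := by exact_mod_cast hn
  rw [div_lt_iff₀ hδ] at hn₀
  rw [div_lt_iff₀ (by positivity)]
  nlinarith

/-- The averages of a curve differ little from those for a refined subdivision. -/
theorem average_sub_average_mem {X : Type*} [AddCommGroup X] [Module ℂ X]
    {c : ℝ≥0 → X} {t : ℝ≥0} {U : Set X} (hU : Convex ℝ U) {δ : ℝ}
    (h : ∀ s ≤ t, ∀ s' ≤ t, dist s s' < δ → c s - c s' ∈ U) {n : ℕ} (hn : (t : ℝ) / (n + 1) < δ)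
    (m : ℕ) : average c t n - average c t ((n + 1) * (m + 1) - 1) ∈ U := by
  -- Index `k` stands for `k + 1` parts, so this index is the common refinement of the subdivisions
  -- with indices `n` and `m`.
  have hN : (n + 1) * (m + 1) - 1 + 1 = (n + 1) * (m + 1) :=
    Nat.sub_add_cancel (Nat.one_le_iff_ne_zero.2 (by positivity))
  have hN' : ((((n + 1) * (m + 1) - 1 : ℕ) : ℝ) + 1) = (n + 1) * (m + 1) := by
    exact_mod_cast hN
  have hN'' : ((((n + 1) * (m + 1) - 1 : ℕ) : ℝ≥0) + 1) = (n + 1) * (m + 1) := by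
    exact_mod_cast hN
  have key : average c t n - average c t ((n + 1) * (m + 1) - 1) =
      ((n : ℝ) + 1)⁻¹ • ∑ i ∈ Finset.range (n + 1), ((m : ℝ) + 1)⁻¹ •
        ∑ j ∈ Finset.range (m + 1), (c (t * i / (n + 1)) -
          c (t * (i * (m + 1) + j : ℕ) / ((n + 1) * (m + 1)))) := by
    rw [average, average, hN, hN', hN'', sum_range_mul_eq, mul_inv, mul_smul, ← smul_sub,
      Finset.smul_sum (r := ((m : ℝ) + 1)⁻¹), ← Finset.sum_sub_distrib]
    congr 1
    refine Finset.sum_congr rfl fun i _ => ?_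
    rw [Finset.sum_sub_distrib, smul_sub, Finset.sum_const, Finset.card_range,
      ← Nat.cast_smul_eq_nsmul ℝ, smul_smul]
    push_cast
    rw [inv_mul_cancel₀ (by positivity), one_smul]
  rw [key]
  refine inv_smul_sum_range_mem hU fun i hi => inv_smul_sum_range_mem hU fun j hj => ?_
  have hi' : (i : ℝ) + 1 ≤ n + 1 := by exact_mod_cast hi
  have hj' : (j : ℝ) + 1 ≤ m + 1 := by exact_mod_cast hj
  have ht : (0 : ℝ) ≤ t := t.2
  refine h _ ?_ _ ?_ ?_
  · rw [← NNReal.coe_le_coe]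
    push_cast
    rw [div_le_iff₀ (by positivity)]
    nlinarith
  · rw [← NNReal.coe_le_coe]
    push_cast
    rw [div_le_iff₀ (by positivity)]
    have : (i : ℝ) * (m + 1) + j ≤ (n + 1) * (m + 1) := by nlinarith
    nlinarith
  · rw [NNReal.dist_eq]
    push_cast
    have : (t : ℝ) * i / (n + 1) - t * (i * (m + 1) + j) / ((n + 1) * (m + 1)) =
        -(t / (n + 1) * (j / (m + 1))) := by
      field_simp
      ring
    rw [this, abs_neg, abs_of_nonneg (by positivity)]
    refine lt_of_le_of_lt (mul_le_of_le_one_right (by positivity) ?_) hn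
    rw [div_le_one (by positivity)]
    linarith

/-- Uniform continuity on the compact interval, for the uniformity of the additive group. -/
theorem exists_forall_sub_mem {X : Type*} [AddCommGroup X] [TopologicalSpace X]
    [IsTopologicalAddGroup X] {c : ℝ≥0 → X} (hc : Continuous c) (t : ℝ≥0) {U : Set X}
    (hU : U ∈ 𝓝 (0 : X)) :
    ∃ δ > 0, ∀ s ≤ t, ∀ s' ≤ t, dist s s' < δ → c s - c s' ∈ U := by
  let := IsTopologicalAddGroup.rightUniformSpace X
  have := isUniformAddGroup_of_addCommGroup (G := X)
  have huc := (isCompact_Icc (a := 0) (b := t)).uniformContinuousOn_of_continuous hc.continuousOn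
  have hV : {x : X × X | x.1 - x.2 ∈ U} ∈ uniformity X := by
    rw [uniformity_eq_comap_nhds_zero_swapped]
    exact preimage_mem_comap hU
  obtain ⟨δ, hδ, h⟩ := Metric.mem_uniformity_dist.1 (mem_inf_principal.1 (huc hV))
  exact ⟨δ, hδ, fun s hs s' hs' hd => h hd ⟨⟨zero_le, hs⟩, ⟨zero_le, hs'⟩⟩⟩

variable {X : Type*} [AddCommGroup X] [Module ℂ X] [TopologicalSpace X] [IsTopologicalAddGroup X]

/-- In a sequentially complete locally convex space continuous curves have Riemann means. -/
theorem exists_tendsto_average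
    (hconv : ∀ W ∈ 𝓝 (0 : X), ∃ U ∈ 𝓝 (0 : X), Convex ℝ U ∧ U ⊆ W)
    (hseq : IsSeqComplete ‹TopologicalSpace X›) {c : ℝ≥0 → X} (hc : Continuous c) (t : ℝ≥0) :
    ∃ M, Tendsto (average c t) atTop (𝓝 M) := by
  refine hseq _ fun W hW => ?_
  obtain ⟨V, hV, hVW⟩ := exists_nhds_half_neg hW
  obtain ⟨U, hU, hUc, hUV⟩ := hconv V hV
  obtain ⟨δ, hδ, h⟩ := exists_forall_sub_mem hc t hU
  obtain ⟨n₀, hn₀⟩ := mesh_lt (t := t) hδ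
  refine mem_atTop_sets.2 ⟨(n₀, n₀), fun k hk => ?_⟩
  have h₁ := average_sub_average_mem hUc h (hn₀ k.1 hk.1) k.2
  have h₂ := average_sub_average_mem hUc h (hn₀ k.2 hk.2) k.1
  rw [mul_comm (k.2 + 1)] at h₂
  have := hVW _ (hUV h₁) _ (hUV h₂)
  rwa [sub_sub_sub_cancel_right] at this

/-- Applied after a continuous functional, this turns vector means into scalar integrals, so no
vector-valued integral is needed. -/
theorem tendsto_average_integral {c : ℝ≥0 → ℂ} (hc : Continuous c) (t : ℝ≥0) :
    Tendsto (fun n => (t : ℝ) • average c t n) atTop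
      (𝓝 (∫ s in (0 : ℝ)..t, c s.toNNReal)) := by
  rw [Metric.tendsto_atTop]
  intro ε hε
  have hη : 0 < ε / (t + 1) := by positivity
  obtain ⟨δ, hδ, h⟩ := exists_forall_sub_mem hc t (Metric.ball_mem_nhds 0 hη)
  obtain ⟨n₀, hn₀⟩ := mesh_lt (t := t) hδ
  refine ⟨n₀, fun n hn => ?_⟩
  have ht : (0 : ℝ) ≤ t := t.2
  let a : ℕ → ℝ := fun i => t * i / (n + 1)
  have ha : ∀ i, a (i + 1) - a i = t / (n + 1) := by
    intro i
    simp only [a]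
    push_cast
    field_simp
    ring
  have hae : ∀ i, (a i).toNNReal = t * i / (n + 1) := by
    intro i
    have : a i = ((t * i / (n + 1) : ℝ≥0) : ℝ) := by simp [a]
    rw [this, Real.toNNReal_coe]
  have hcont : Continuous fun s : ℝ => c s.toNNReal := hc.comp continuous_real_toNNReal
  have hsum : ∫ s in (0 : ℝ)..t, c s.toNNReal =
      ∑ i ∈ Finset.range (n + 1), ∫ s in a i..a (i + 1), c s.toNNReal := by
    rw [intervalIntegral.sum_integral_adjacent_intervals fun i _ =>
      hcont.intervalIntegrable _ _]
    congr 1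
    · simp [a]
    · simp only [a]
      push_cast
      field_simp
  have havg : (t : ℝ) • average c t n =
      ∑ i ∈ Finset.range (n + 1), ∫ _ in a i..a (i + 1), c (a i).toNNReal := by
    simp only [intervalIntegral.integral_const, ha, hae, average]
    rw [Finset.smul_sum, Finset.smul_sum]
    refine Finset.sum_congr rfl fun i _ => ?_
    rw [smul_smul]
    rfl
  rw [dist_eq_norm, hsum, havg, ← Finset.sum_sub_distrib]
  have hbound : ∀ i ∈ Finset.range (n + 1),
      ‖(∫ _ in a i..a (i + 1), c (a i).toNNReal) - ∫ s in a i..a (i + 1), c s.toNNReal‖ ≤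
        ε / (t + 1) * (t / (n + 1)) := by
    intro i hi
    have hi' : ((i + 1 : ℕ) : ℝ) ≤ n + 1 := by exact_mod_cast Finset.mem_range.1 hi
    have hai : a (i + 1) ≤ t := by
      simp only [a]
      rw [div_le_iff₀ (by positivity)]
      nlinarith
    have h0 : 0 ≤ a i := by positivity
    have hd : 0 ≤ (t : ℝ) / (n + 1) := by positivity
    rw [← intervalIntegral.integral_sub (by simp) (hcont.intervalIntegrable _ _)]
    refine (intervalIntegral.norm_integral_le_of_norm_le_const (C := ε / (t + 1))
      fun s hs => ?_).trans_eq (by rw [ha, abs_of_nonneg hd])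
    rw [uIoc_of_le (by linarith [ha i])] at hs
    have := h (a i).toNNReal (Real.toNNReal_le_iff_le_coe.2 (by linarith [ha i])) s.toNNReal
      (Real.toNNReal_le_iff_le_coe.2 (hs.2.trans hai)) (by
        rw [NNReal.dist_eq, Real.coe_toNNReal _ h0, Real.coe_toNNReal _ (h0.trans hs.1.le),
          abs_sub_comm, abs_of_pos (sub_pos.2 hs.1)]
        linarith [ha i, hn₀ n hn, hs.2])
    simpa using (mem_ball_zero_iff.1 this).le
  refine (norm_sum_le_of_le _ hbound).trans_lt ?_
  rw [Finset.sum_const, Finset.card_range, nsmul_eq_mul]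
  push_cast
  have : ((n : ℝ) + 1) * (ε / (t + 1) * (t / (n + 1))) = ε * (t / (t + 1)) := by field_simp
  rw [this]
  refine mul_lt_of_lt_one_right hε ?_
  rw [div_lt_one (by positivity)]
  linarith

/-- Riemann means over shrinking intervals converge to the value at the origin. -/
theorem tendsto_mean (hconv : ∀ W ∈ 𝓝 (0 : X), ∃ U ∈ 𝓝 (0 : X), Convex ℝ U ∧ U ⊆ W)
    {c : ℝ≥0 → X} (hc : Continuous c) {M : ℝ≥0 → X}
    (hM : ∀ t, Tendsto (average c t) atTop (𝓝 (M t))) :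
    Tendsto M (𝓝[>] 0) (𝓝 (c 0)) := by
  rw [← tendsto_sub_nhds_zero_iff]
  intro W hW
  -- `V` is closed so that the limits `M t` of the averages stay in it.
  obtain ⟨V, hV, hVc, hVW⟩ := exists_mem_nhds_isClosed_subset hW
  obtain ⟨U, hU, hUc, hUV⟩ := hconv V hV
  obtain ⟨δ, hδ, h⟩ := exists_forall_sub_mem hc 1 hU
  have hsmall : ∀ᶠ t : ℝ≥0 in 𝓝[>] 0, dist t 0 < min δ 1 :=
    nhdsWithin_le_nhds (Metric.ball_mem_nhds _ (by positivity))
  refine mem_map.2 ?_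
  filter_upwards [hsmall] with t ht
  refine hVW (hVc.mem_of_tendsto ((hM t).sub_const (c 0)) (Eventually.of_forall fun n => hUV ?_))
  have key : average c t n - c 0 =
      ((n : ℝ) + 1)⁻¹ • ∑ i ∈ Finset.range (n + 1), (c (t * i / (n + 1)) - c 0) := by
    rw [average, Finset.sum_sub_distrib, smul_sub, Finset.sum_const, Finset.card_range,
      ← Nat.cast_smul_eq_nsmul ℝ, smul_smul]
    push_cast
    rw [inv_mul_cancel₀ (by positivity), one_smul]
  rw [key]
  refine inv_smul_sum_range_mem hUc fun i hi => ?_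
  have hi' : (i : ℝ) + 1 ≤ n + 1 := by exact_mod_cast hi
  have ht0 : (0 : ℝ) ≤ t := t.2
  rw [NNReal.dist_eq, NNReal.coe_zero, sub_zero, abs_of_nonneg ht0, lt_min_iff] at ht
  have hle : (t : ℝ) * i / (n + 1) ≤ t := by
    rw [div_le_iff₀ (by positivity)]
    nlinarith
  refine h _ ?_ _ zero_le_one ?_
  · rw [← NNReal.coe_le_coe]
    push_cast
    linarith
  · rw [NNReal.dist_eq]
    push_cast
    rw [sub_zero, abs_of_nonneg (by positivity)]
    linarith

/-- In a sequentially complete locally convex space with a separating family of continuous linear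
functionals the domain of the generator of a strongly continuous semigroup is dense. -/
theorem exists_tendsto_mem_generatorDomain [ContinuousSMul ℂ X]
    (hconv : ∀ W ∈ 𝓝 (0 : X), ∃ U ∈ 𝓝 (0 : X), Convex ℝ U ∧ U ⊆ W)
    (hseq : IsSeqComplete ‹TopologicalSpace X›)
    {T : ℝ≥0 → X →ₗ[ℂ] X} (hT : IsStronglyContSemigroup ‹TopologicalSpace X› T)
    {Z : Type*} (ev : Z → X →ₗ[ℂ] ℂ) (hev : ∀ z, Continuous (ev z))
    (hsep : ∀ x y, (∀ z, ev z x = ev z y) → x = y) (x : X) :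
    ∃ M : ℝ≥0 → X, (∀ t > 0, M t ∈ generatorDomain ‹TopologicalSpace X› T) ∧
      Tendsto M (𝓝[>] 0) (𝓝 x) := by
  choose M hM using exists_tendsto_average hconv hseq (hT.orbit x)
  have hlim : Tendsto M (𝓝[>] 0) (𝓝 x) := by
    have := tendsto_mean hconv (hT.orbit x) hM
    rwa [hT.zero] at this
  refine ⟨M, fun h hh => ⟨(((h : ℝ) : ℂ)⁻¹) • (T h x - x), ?_⟩, hlim⟩
  have hint : ∀ (t h : ℝ≥0) z, ((h : ℝ) : ℂ) * ev z (T t (M h)) =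
      ∫ s in (t : ℝ)..(t + h), ev z (T s.toNNReal x) := by
    intro t h z
    have hcont : Continuous fun s => ev z (T t (T s x)) :=
      (hev z).comp ((hT.cont t).comp (hT.orbit x))
    have h₁ : Tendsto (fun n => (h : ℝ) • average (fun s => ev z (T t (T s x))) h n) atTop
        (𝓝 ((h : ℝ) • ev z (T t (M h)))) := by
      refine Tendsto.const_smul ?_ _
      have := (((hev z).comp (hT.cont t)).tendsto (M h)).comp (hM h)
      refine this.congr fun n => ?_
      exact map_average (ev z ∘ₗ T t) _ _ _
    have h₂ := tendsto_nhds_unique h₁ (tendsto_average_integral hcont h)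
    rw [Complex.real_smul] at h₂
    rw [h₂]
    have h₃ := intervalIntegral.integral_comp_add_left (a := 0) (b := h)
      (fun s : ℝ => ev z (T s.toNNReal x)) (t : ℝ)
    rw [add_zero] at h₃
    rw [← h₃]
    refine intervalIntegral.integral_congr fun s hs => ?_
    rw [uIcc_of_le (NNReal.coe_nonneg h)] at hs
    have : (t + s : ℝ).toNNReal = t + s.toNNReal := by
      rw [Real.toNNReal_add t.coe_nonneg hs.1, Real.toNNReal_coe]
    simp only [this, hT.add]
    rfl
  -- Up to the factor `1/(th)`, both sides are the integral over `[t, t + h]` minus those over `[0,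
  -- t]` and `[0, h]`, rearranged. The symmetry in `t` and `h` moves the limit `t → 0` onto `M t →
  -- x`.
  have key : ∀ t : ℝ≥0, 0 < t → ((t : ℝ) : ℂ)⁻¹ • (T t (M h) - M h) =
      ((h : ℝ) : ℂ)⁻¹ • (T h (M t) - M t) := by
    intro t ht
    have ht' : ((t : ℝ) : ℂ) ≠ 0 := by exact_mod_cast ht.ne'
    have hh' : ((h : ℝ) : ℂ) ≠ 0 := by exact_mod_cast hh.ne'
    refine hsep _ _ fun z => ?_
    have hM0 : ∀ h, M h = T 0 (M h) := fun h => by rw [hT.zero]; rfl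
    have e₁ := hint t h z
    have e₂ := hint 0 h z
    have e₃ := hint h t z
    have e₄ := hint 0 t z
    rw [← hM0] at e₂ e₄
    have hk : Continuous fun s : ℝ => ev z (T s.toNNReal x) :=
      ((hev z).comp (hT.orbit x)).comp continuous_real_toNNReal
    have hi : ∀ a b : ℝ, IntervalIntegrable (fun s : ℝ => ev z (T s.toNNReal x))
        MeasureTheory.volume a b := fun a b => hk.intervalIntegrable a b
    have e₅ := intervalIntegral.integral_add_adjacent_intervals (hi 0 t) (hi t (t + h))
    have e₆ := intervalIntegral.integral_add_adjacent_intervals (hi 0 h) (hi h (h + t))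
    rw [add_comm (h : ℝ) t] at e₃ e₆
    simp only [NNReal.coe_zero, zero_add] at e₂ e₄
    rw [map_smul, map_smul, map_sub, map_sub, smul_eq_mul, smul_eq_mul]
    field_simp
    linear_combination e₁ - e₂ - e₃ + e₄ + e₅ - e₆
  have := (((hT.cont h).tendsto x).comp hlim).sub hlim
  have := this.const_smul ((h : ℝ) : ℂ)⁻¹
  refine this.congr' ?_
  filter_upwards [self_mem_nhdsWithin] with t ht
  exact (key t ht).symm

end Average

/-! ### Bounded quotients and a Schwarz–Pick estimate. -/

section Quotient

open Metric

/-- If `m` is not identically zero and `q / m` takes values in the closed unit disc off the zeros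
of `m`, then `q / m` extends holomorphically. -/
theorem exists_differentiableOn_quotient {m q : ℂ → ℂ} (hm : DifferentiableOn ℂ m (ball 0 1))
    (hq : DifferentiableOn ℂ q (ball 0 1)) (hm0 : m 0 ≠ 0)
    (hdiv : ∀ z ∈ ball (0 : ℂ) 1, ∀ a : ℂ, 1 < ‖a‖ → a * m z = q z → m z = 0) :
    ∃ Φ : ℂ → ℂ, DifferentiableOn ℂ Φ (ball 0 1) ∧ (∀ z ∈ ball (0 : ℂ) 1, ‖Φ z‖ ≤ 1) ∧
      ∀ z ∈ ball (0 : ℂ) 1, q z = Φ z * m z := by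
  let Φ : ℂ → ℂ := fun z => limUnder (𝓝[≠] z) fun w => q w / m w
  -- The zeros of `m` are isolated because `m 0 ≠ 0`; as the quotient is bounded by 1 off them, they
  -- are removable.
  have hpun : ∀ z ∈ ball (0 : ℂ) 1, ∀ᶠ w in 𝓝[≠] z, w ∈ ball (0 : ℂ) 1 ∧ m w ≠ 0 := by
    intro z hz
    have hball : ∀ᶠ w in 𝓝[≠] z, w ∈ ball (0 : ℂ) 1 :=
      nhdsWithin_le_nhds (isOpen_ball.mem_nhds hz)
    refine hball.and ?_
    by_contra hcon
    have hfr : ∃ᶠ w in 𝓝[≠] z, m w = 0 := hcon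
    exact hm0 ((hm.analyticOnNhd isOpen_ball).eqOn_zero_of_preconnected_of_frequently_eq_zero
      (convex_ball 0 1).isPreconnected hz hfr (mem_ball_self one_pos))
  have hdiff : ∀ w ∈ ball (0 : ℂ) 1, m w ≠ 0 → DifferentiableAt ℂ (fun w => q w / m w) w :=
    fun w hw hmw => (hq.differentiableAt (isOpen_ball.mem_nhds hw)).div
      (hm.differentiableAt (isOpen_ball.mem_nhds hw)) hmw
  have hle : ∀ w ∈ ball (0 : ℂ) 1, m w ≠ 0 → ‖q w / m w‖ ≤ 1 := by
    intro w hw hmw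
    by_contra! hcon
    exact hmw (hdiv w hw _ hcon (div_mul_cancel₀ _ hmw))
  have hΦ : ∀ w ∈ ball (0 : ℂ) 1, m w ≠ 0 → Φ w = q w / m w := fun w hw hmw =>
    ((hdiff w hw hmw).continuousAt.tendsto.mono_left nhdsWithin_le_nhds).limUnder_eq
  have hd : ∀ z ∈ ball (0 : ℂ) 1, DifferentiableAt ℂ Φ z := by
    intro z hz
    obtain ⟨s, hs, hsz⟩ := mem_nhdsWithin_iff_exists_mem_nhds_inter.1 (hpun z hz)
    have hs' : ∀ w ∈ s \ {z}, w ∈ ball (0 : ℂ) 1 ∧ m w ≠ 0 := fun w hw => hsz hw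
    have := Complex.differentiableOn_update_limUnder_of_bddAbove (f := fun w => q w / m w) hs
      (fun w hw => (hdiff w (hs' w hw).1 (hs' w hw).2).differentiableWithinAt)
      ⟨1, by rintro _ ⟨w, hw, rfl⟩; exact hle w (hs' w hw).1 (hs' w hw).2⟩
    refine (this.differentiableAt hs).congr_of_eventuallyEq ?_
    filter_upwards [hs] with w hw
    rcases eq_or_ne w z with rfl | hne
    · rw [Function.update_self]
    · rw [Function.update_of_ne hne]
      exact hΦ w (hs' w ⟨hw, hne⟩).1 (hs' w ⟨hw, hne⟩).2
  refine ⟨Φ, fun z hz => (hd z hz).differentiableWithinAt, fun z hz => ?_, fun z hz => ?_⟩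
  · refine le_of_tendsto ((hd z hz).continuousAt.norm.tendsto.mono_left
      (nhdsWithin_le_nhds (s := {z}ᶜ))) ?_
    filter_upwards [hpun z hz] with w hw
    rw [hΦ w hw.1 hw.2]
    exact hle w hw.1 hw.2
  · have h₁ := (hq.differentiableAt (isOpen_ball.mem_nhds hz)).continuousAt.tendsto.mono_left
      (nhdsWithin_le_nhds (s := {z}ᶜ))
    have h₂ := ((hd z hz).continuousAt.mul
      (hm.differentiableAt (isOpen_ball.mem_nhds hz)).continuousAt).tendsto.mono_left
      (nhdsWithin_le_nhds (s := {z}ᶜ))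
    refine tendsto_nhds_unique h₁ (h₂.congr' ?_)
    filter_upwards [hpun z hz] with w hw
    simp only [Pi.mul_apply]
    rw [hΦ w hw.1 hw.2, div_mul_cancel₀ _ hw.2]

/-- Measures how far the Möbius map `x ↦ (x - c)/(1 - c̄x)` stays from the unit circle. -/
theorem normSq_one_sub_conj_mul (c x : ℂ) :
    ‖1 - (starRingEnd ℂ) c * x‖ ^ 2 - ‖x - c‖ ^ 2 = (1 - ‖c‖ ^ 2) * (1 - ‖x‖ ^ 2) := by
  simp only [← Complex.normSq_eq_norm_sq, Complex.normSq_apply]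
  simp
  ring

/-- A consequence of the Schwarz–Pick lemma. -/
theorem one_sub_norm_sq_ge_of_mapsTo {Φ : ℂ → ℂ} (hΦ : DifferentiableOn ℂ Φ (ball 0 1))
    (hmaps : ∀ z ∈ ball (0 : ℂ) 1, ‖Φ z‖ ≤ 1) {ρ : ℝ} (hρ : ρ < 1) (h0 : ‖Φ 0‖ ≤ ρ) {z : ℂ}
    (hz : z ∈ ball (0 : ℂ) 1) : (1 - ρ) ^ 2 * (1 - ‖z‖ ^ 2) ≤ 1 - ‖Φ z‖ ^ 2 := by
  set c := Φ 0 with hc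
  have hden : ∀ w ∈ ball (0 : ℂ) 1, 1 - ‖c‖ ≤ ‖1 - (starRingEnd ℂ) c * Φ w‖ := by
    intro w hw
    have h₁ := norm_sub_norm_le (1 : ℂ) ((starRingEnd ℂ) c * Φ w)
    rw [norm_mul, RCLike.norm_conj, norm_one] at h₁
    have h₂ := mul_le_of_le_one_right (norm_nonneg c) (hmaps w hw)
    linarith
  have hc1 : 0 < 1 - ‖c‖ := by linarith
  have hne : ∀ w ∈ ball (0 : ℂ) 1, 1 - (starRingEnd ℂ) c * Φ w ≠ 0 := fun w hw =>
    norm_pos_iff.1 (hc1.trans_le (hden w hw))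
  have hle : ∀ w ∈ ball (0 : ℂ) 1,
      ‖(Φ w - c) / (1 - (starRingEnd ℂ) c * Φ w)‖ ≤ 1 := by
    intro w hw
    rw [norm_div, div_le_one (norm_pos_iff.2 (hne w hw))]
    refine le_of_sq_le_sq ?_ (norm_nonneg _)
    have h₁ := normSq_one_sub_conj_mul c (Φ w)
    have h₂ : 0 ≤ (1 - ‖c‖ ^ 2) * (1 - ‖Φ w‖ ^ 2) := by
      have h₃ : ‖c‖ ^ 2 ≤ 1 := pow_le_one₀ (norm_nonneg _) (by linarith)
      have h₄ : ‖Φ w‖ ^ 2 ≤ 1 := pow_le_one₀ (norm_nonneg _) (hmaps w hw)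
      exact mul_nonneg (by linarith) (by linarith)
    linarith
  -- Schwarz lemma for `Φ` followed by the Möbius map that sends `Φ 0` to 0.
  have hS := Complex.norm_le_norm_of_mapsTo_ball (R := 1) (z := z)
    (f := fun w => (Φ w - c) / (1 - (starRingEnd ℂ) c * Φ w))
    ((hΦ.sub_const c).div ((differentiableOn_const 1).sub (hΦ.const_mul _)) hne)
    (fun w hw => mem_closedBall_zero_iff.2 (hle w hw)) (by simp [hc]) (mem_ball_zero_iff.1 hz)
  rw [norm_div, div_le_iff₀ (norm_pos_iff.2 (hne z hz))] at hS
  have hz1 := mem_ball_zero_iff.1 hz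
  have h₁ := normSq_one_sub_conj_mul c (Φ z)
  have h₂ := hden z hz
  have h₃ : ‖Φ z - c‖ ^ 2 ≤ ‖z‖ ^ 2 * ‖1 - (starRingEnd ℂ) c * Φ z‖ ^ 2 := by
    rw [← mul_pow]
    exact pow_le_pow_left₀ (norm_nonneg _) hS 2
  have h₄ : 0 ≤ 1 - ‖z‖ ^ 2 := by
    have := pow_le_one₀ (norm_nonneg z) hz1.le (n := 2)
    linarith
  have h₅ : (1 - ρ) ^ 2 ≤ ‖1 - (starRingEnd ℂ) c * Φ z‖ ^ 2 :=
    pow_le_pow_left₀ (by linarith) (by linarith) 2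
  have h₆ : 0 ≤ 1 - ‖Φ z‖ ^ 2 := by
    have := pow_le_one₀ (norm_nonneg _) (hmaps z hz) (n := 2)
    linarith
  have h₇ := mul_le_mul_of_nonneg_right h₅ h₄
  -- The factor `1 - ‖c‖²` next to `1 - ‖Φ z‖²` is at most 1 and can be dropped.
  nlinarith [sq_nonneg ‖c‖]

theorem norm_le_mul_norm_of_quotient {m q : ℂ → ℂ} (hm : DifferentiableOn ℂ m (ball 0 1))
    (hq : DifferentiableOn ℂ q (ball 0 1)) (hm0 : m 0 ≠ 0)
    (hdiv : ∀ z ∈ ball (0 : ℂ) 1, ∀ a : ℂ, 1 < ‖a‖ → a * m z = q z → m z = 0)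
    {ρ : ℝ} (hρ : ρ < 1) (h0 : ‖q 0‖ ≤ ρ * ‖m 0‖) {z : ℂ} (hz : z ∈ ball (0 : ℂ) 1) :
    ‖q z‖ ≤ √(1 - (1 - ρ) ^ 2 * (1 - ‖z‖ ^ 2)) * ‖m z‖ := by
  obtain ⟨Φ, hΦ, hmaps, hqΦ⟩ := exists_differentiableOn_quotient hm hq hm0 hdiv
  have hΦ0 : ‖Φ 0‖ ≤ ρ := by
    rw [hqΦ 0 (mem_ball_self one_pos), norm_mul] at h0
    exact le_of_mul_le_mul_right h0 (norm_pos_iff.2 hm0)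
  have := one_sub_norm_sq_ge_of_mapsTo hΦ hmaps hρ hΦ0 hz
  rw [hqΦ z hz, norm_mul]
  exact mul_le_mul_of_nonneg_right (Real.le_sqrt_of_sq_le (by linarith)) (norm_nonneg _)

end Quotient

/-! ### Characteristic curves: local existence and continuation. -/

section Solution

/-- `w` is a curve in the unit disc which solves `w' = G(w)` on `[0, a)`, with one-sided
derivatives. -/
structure IsSolution (G : ℂ → ℂ) (w : ℝ → disc) (a : ℝ) : Prop where
  cont : Continuous w
  deriv : ∀ τ ∈ Ico 0 a, HasDerivWithinAt (fun s => (w s : ℂ)) (G (w τ)) (Ici τ) τ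

theorem IsSolution.mono {G : ℂ → ℂ} {w : ℝ → disc} {a b : ℝ} (h : IsSolution G w a)
    (hba : b ≤ a) : IsSolution G w b :=
  ⟨h.cont, fun τ hτ => h.deriv τ ⟨hτ.1, hτ.2.trans_le hba⟩⟩

/-- Concatenation of solutions. -/
theorem IsSolution.append {G : ℂ → ℂ} {w v : ℝ → disc} {a b : ℝ} (ha : 0 ≤ a)
    (hw : IsSolution G w a) (hv : IsSolution G v b) (hwv : v 0 = w a) :
    ∃ u : ℝ → disc, u 0 = w 0 ∧ IsSolution G u (a + b) := by
  have hu : ∀ s : ℝ, a ≤ s → (if s ≤ a then w s else v (s - a)) = v (s - a) := by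
    intro s hs
    rcases hs.eq_or_lt with rfl | hs
    · simp [hwv]
    · rw [if_neg hs.not_ge]
  refine ⟨fun s => if s ≤ a then w s else v (s - a), by simp [ha], ?_, fun τ hτ => ?_⟩
  · refine Continuous.if_le hw.cont (hv.cont.comp (by fun_prop)) continuous_id continuous_const ?_
    rintro s rfl
    simp [hwv]
  · rcases lt_or_ge τ a with hτa | hτa
    · simp only [if_pos hτa.le]
      refine (hw.deriv τ ⟨hτ.1, hτa⟩).congr_of_eventuallyEq ?_ (by simp [hτa.le])
      filter_upwards [nhdsWithin_le_nhds (Iio_mem_nhds hτa)] with s hs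
      simp [(mem_Iio.1 hs).le]
    · rw [hu τ hτa]
      have h₁ := hv.deriv (τ - a) ⟨by linarith, by linarith [hτ.2]⟩
      have h₂ : HasDerivWithinAt (fun s : ℝ => s - a) 1 (Ici τ) τ :=
        (hasDerivAt_id τ).sub_const a |>.hasDerivWithinAt
      have h₃ := h₁.scomp (t' := Ici (τ - a)) τ h₂ fun s hs => by
        simpa using hs
      rw [one_smul] at h₃
      refine h₃.congr (fun s hs => ?_) ?_
      · rw [hu s (hτa.trans hs)]
        rfl
      · rw [hu τ hτa]
        rfl

/-- Local solutions with starting points in a compact subset exist on a uniform time interval. -/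
theorem exists_isSolution {G : ℂ → ℂ} (hG : DifferentiableOn ℂ G (Metric.ball 0 1)) {R : ℝ}
    (hR : R < 1) :
    ∃ ε > 0, ∀ x : disc, ‖(x : ℂ)‖ ≤ R → ∃ w : ℝ → disc, w 0 = x ∧ IsSolution G w ε := by
  obtain ⟨R', hRR', hR'⟩ := exists_between hR
  have hsub : Metric.closedBall (0 : ℂ) R' ⊆ Metric.ball 0 1 := Metric.closedBall_subset_ball hR'
  have hK := isCompact_closedBall (0 : ℂ) R'
  obtain ⟨L, hL⟩ := hK.exists_bound_of_continuousOn (hG.continuousOn.mono hsub)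
  obtain ⟨K, hK⟩ := hK.exists_bound_of_continuousOn
    ((hG.deriv Metric.isOpen_ball).continuousOn.mono hsub)
  let a : ℝ≥0 := (R' - R).toNNReal
  have ha : (a : ℝ) = R' - R := Real.coe_toNNReal _ (by linarith)
  -- At speed at most `L` a curve needs at least this long to travel from radius `R` to `R'`; the `+
  -- 1` keeps the denominator positive.
  let ε : ℝ := a / (L.toNNReal + 1)
  have hε : 0 < ε := div_pos (by linarith) (by positivity)
  refine ⟨ε, hε, fun x hx => ?_⟩
  have hball : Metric.closedBall (x : ℂ) a ⊆ Metric.closedBall 0 R' :=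
    Metric.closedBall_subset_closedBall' (by rw [dist_zero_right, ha]; linarith)
  have hlip : LipschitzOnWith K.toNNReal G (Metric.closedBall (x : ℂ) a) := by
    refine (convex_closedBall (x : ℂ) a).lipschitzOnWith_of_nnnorm_deriv_le (𝕜 := ℂ) ?_ ?_
    · exact fun y hy => hG.differentiableAt (Metric.isOpen_ball.mem_nhds (hsub (hball hy)))
    · intro y hy
      rw [← NNReal.coe_le_coe]
      exact (hK y (hball hy)).trans (Real.le_coe_toNNReal K)
  have hPL : IsPicardLindelof (fun _ => G) (tmin := 0) (tmax := ε) ⟨0, le_rfl, hε.le⟩ (x : ℂ) a 0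
      L.toNNReal K.toNNReal := by
    refine IsPicardLindelof.of_time_independent
      (fun y hy => (hL y (hball hy)).trans (Real.le_coe_toNNReal L)) hlip ?_
    simp only [sub_zero, sub_self, NNReal.coe_zero]
    rw [max_eq_left hε.le]
    simp only [ε]
    rw [mul_div_assoc', div_le_iff₀ (by positivity), mul_comm]
    exact mul_le_mul_of_nonneg_left (by linarith) a.coe_nonneg
  obtain ⟨α, hα⟩ := ODE.FunSpace.exists_isFixedPt_next hPL (x := (x : ℂ)) (by simp)
  -- `compProj` freezes the curve outside `[0, ε]`, which makes it continuous on the whole line.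
  refine ⟨fun s => ⟨α.compProj s, hsub (hball (α.compProj_mem_closedBall hPL.mul_max_le))⟩, ?_,
    α.continuous_compProj.subtype_mk _, fun τ hτ => ?_⟩
  · ext
    have := ODE.FunSpace.compProj_val (α := α) (t := ⟨0, le_rfl, hε.le⟩)
    simp only at this ⊢
    rw [this, ← hα, ODE.FunSpace.next_apply₀]
  · have hτ' : τ ∈ Icc 0 ε := ⟨hτ.1, hτ.2.le⟩
    have h₁ : HasDerivWithinAt α.compProj (G (α.compProj τ)) (Icc 0 ε) τ := by
      refine (ODE.hasDerivWithinAt_picard_Icc (f := fun _ => G) ⟨le_rfl, hε.le⟩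
        hPL.continuousOn_uncurry α.continuous_compProj.continuousOn
        (fun _ _ => α.compProj_mem_closedBall hPL.mul_max_le) (x : ℂ) hτ').congr_of_mem ?_ hτ'
      intro s hs
      nth_rw 1 [← hα]
      rw [ODE.FunSpace.compProj_of_mem hs, ODE.FunSpace.next_apply]
    exact h₁.mono_of_mem_nhdsWithin (Icc_mem_nhdsGE_of_mem hτ)

/-- If solutions starting at `x` stay in a compact subset during `[0, a]`, then there is one that
exists on `[0, a]`. -/
theorem exists_isSolution_of_bound {G : ℂ → ℂ} (hG : DifferentiableOn ℂ G (Metric.ball 0 1))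
    {x : disc} {a R : ℝ} (ha : 0 ≤ a) (hR : R < 1)
    (hbound : ∀ s ∈ Icc 0 a, ∀ w : ℝ → disc, w 0 = x → IsSolution G w s → ‖(w s : ℂ)‖ ≤ R) :
    ∃ w : ℝ → disc, w 0 = x ∧ IsSolution G w a := by
  obtain ⟨ε, hε, hloc⟩ := exists_isSolution hG hR
  -- The a priori bound keeps each endpoint within radius `R`, so every continuation gains the same
  -- `ε`.
  have hstep : ∀ k : ℕ, ∃ w : ℝ → disc, w 0 = x ∧ IsSolution G w (min a (k * ε)) := by
    intro k
    induction k with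
    | zero => exact ⟨fun _ => x, rfl, continuous_const, fun τ hτ => by simp_all⟩
    | succ k ih =>
      obtain ⟨w, hw0, hw⟩ := ih
      have hk : 0 ≤ min a (k * ε) := by positivity
      obtain ⟨v, hv0, hv⟩ := hloc _ (hbound _ ⟨hk, min_le_left _ _⟩ w hw0 hw)
      obtain ⟨u, hu0, hu⟩ := hw.append hk hv hv0
      refine ⟨u, hu0.trans hw0, hu.mono ?_⟩
      push_cast
      rcases le_total a (k * ε) with h | h
      · rw [min_eq_left h]
        exact (min_le_left _ _).trans (by linarith)
      · rw [min_eq_right h]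
        exact (min_le_right _ _).trans (by linarith)
  obtain ⟨k, hk⟩ := exists_nat_ge (a / ε)
  obtain ⟨w, hw0, hw⟩ := hstep k
  rw [min_eq_left ((div_le_iff₀ hε).1 hk)] at hw
  exact ⟨w, hw0, hw⟩

/-- If all solutions exist on a common time interval, then they exist for all times. -/
theorem exists_isSolution_of_uniform {G : ℂ → ℂ} {ε : ℝ} (hε : 0 < ε)
    (h : ∀ x : disc, ∃ w : ℝ → disc, w 0 = x ∧ IsSolution G w ε) (a : ℝ) (x : disc) :
    ∃ w : ℝ → disc, w 0 = x ∧ IsSolution G w a := by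
  have hstep : ∀ k : ℕ, ∃ w : ℝ → disc, w 0 = x ∧ IsSolution G w (k * ε) := by
    intro k
    induction k with
    | zero => exact ⟨fun _ => x, rfl, continuous_const, fun τ hτ => by simp_all⟩
    | succ k ih =>
      obtain ⟨w, hw0, hw⟩ := ih
      obtain ⟨v, hv0, hv⟩ := h (w (k * ε))
      obtain ⟨u, hu0, hu⟩ := hw.append (by positivity) hv hv0
      refine ⟨u, hu0.trans hw0, hu.mono ?_⟩
      push_cast
      linarith
  obtain ⟨k, hk⟩ := exists_nat_ge (a / ε)
  obtain ⟨w, hw0, hw⟩ := hstep k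
  exact ⟨w, hw0, hw.mono ((div_le_iff₀ hε).1 hk)⟩

end Solution

/-! ### The semigroup along characteristic curves. -/

section Characteristics

variable {F : Submodule ℂ C(disc, ℂ)} {σ : TopologicalSpace F}

theorem tendsto_eval (hσ : σ ≤ coTopology F) {α : Type*} {l : Filter α} {u : α → F} {x : F}
    (h : Tendsto u l (@nhds F σ x)) (z : disc) :
    Tendsto (fun a => (u a : C(disc, ℂ)) z) l (𝓝 ((x : C(disc, ℂ)) z)) := by
  have h₁ : Tendsto u l (@nhds F (coTopology F) x) := h.mono_right (nhds_mono hσ)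
  rw [nhds_induced, tendsto_comap_iff] at h₁
  exact ((continuous_eval_const z).tendsto (x : C(disc, ℂ))).comp h₁

theorem IsStronglyContSemigroup.continuous_coe (hσ : σ ≤ coTopology F) {T : ℝ≥0 → F →ₗ[ℂ] F}
    (hT : IsStronglyContSemigroup σ T) (f : F) :
    Continuous fun t => (T t f : C(disc, ℂ)) :=
  continuous_induced_rng.1 (continuous_le_rng hσ (hT.orbit f))

theorem IsStronglyContSemigroup.continuous_eval (hσ : σ ≤ coTopology F) {T : ℝ≥0 → F →ₗ[ℂ] F}
    (hT : IsStronglyContSemigroup σ T) (f : F) :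
    Continuous fun q : ℝ≥0 × disc => (T q.1 f : C(disc, ℂ)) q.2 :=
  have : LocallyCompactSpace disc := disc.isOpen.locallyCompactSpace
  ContinuousEval.continuous_eval.comp
    (((hT.continuous_coe hσ f).comp continuous_fst).prodMk continuous_snd)

theorem HasGeneratorValue.apply {T : ℝ≥0 → F →ₗ[ℂ] F} (hT : IsStronglyContSemigroup σ T) {f y : F}
    (h : HasGeneratorValue σ T f y) (t : ℝ≥0) : HasGeneratorValue σ T (T t f) (T t y) := by
  have h₁ := (@Continuous.tendsto F F σ σ _ (hT.cont t) y).comp h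
  refine h₁.congr fun s => ?_
  have : T t (T s f) = T s (T t f) := by
    rw [← LinearMap.comp_apply, ← LinearMap.comp_apply, ← hT.add, ← hT.add, add_comm]
  simp [this]

/-- `T t` commutes with the difference quotients. Since these are taken as `t → 0+`, they directly
give right derivatives only. -/
theorem HasGeneratorValue.hasDerivWithinAt (hσ : σ ≤ coTopology F) {T : ℝ≥0 → F →ₗ[ℂ] F}
    (hT : IsStronglyContSemigroup σ T) {f y : F} (h : HasGeneratorValue σ T f y) (z : disc) {t : ℝ}
    (ht : 0 ≤ t) :
    HasDerivWithinAt (fun s : ℝ => (T s.toNNReal f : C(disc, ℂ)) z)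
      ((T t.toNNReal y : C(disc, ℂ)) z) (Ici t) t := by
  rw [← hasDerivWithinAt_Ioi_iff_Ici, hasDerivWithinAt_iff_tendsto_slope' self_notMem_Ioi]
  have h₁ := tendsto_eval hσ (h.apply hT t.toNNReal) z
  have h₂ : Tendsto (fun s : ℝ => (s - t).toNNReal) (𝓝[>] t) (𝓝[>] 0) := by
    refine tendsto_nhdsWithin_of_tendsto_nhds_of_eventually_within _ ?_ ?_
    · have : Continuous fun s : ℝ => (s - t).toNNReal := by fun_prop
      simpa using (this.tendsto t).mono_left nhdsWithin_le_nhds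
    · filter_upwards [self_mem_nhdsWithin] with s hs
      exact Real.toNNReal_pos.2 (sub_pos.2 hs)
  refine (h₁.comp h₂).congr' ?_
  filter_upwards [self_mem_nhdsWithin] with s hs
  have hst : 0 ≤ s - t := (sub_pos.2 hs).le
  have hs' : s.toNNReal = (s - t).toNNReal + t.toNNReal := by
    rw [← Real.toNNReal_add hst ht, sub_add_cancel]
  simp only [Function.comp_apply, slope_def_module]
  rw [hs', hT.add, Real.coe_toNNReal _ hst]
  simp

/-- Fundamental theorem of calculus for the orbit of an element of the domain. -/
theorem HasGeneratorValue.integral_eq (hσ : σ ≤ coTopology F) {T : ℝ≥0 → F →ₗ[ℂ] F}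
    (hT : IsStronglyContSemigroup σ T) {f y : F} (h : HasGeneratorValue σ T f y) (z : disc)
    {b c : ℝ} (hb : 0 ≤ b) (hbc : b ≤ c) :
    ∫ r in b..c, (T r.toNNReal y : C(disc, ℂ)) z =
      (T c.toNNReal f : C(disc, ℂ)) z - (T b.toNNReal f : C(disc, ℂ)) z := by
  have hc : ∀ x : F, Continuous fun r : ℝ => (T r.toNNReal x : C(disc, ℂ)) z := fun x =>
    (hT.continuous_eval hσ x).comp (continuous_real_toNNReal.prodMk continuous_const)
  refine intervalIntegral.integral_eq_sub_of_hasDeriv_right (hc f).continuousOn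
    (fun r hr => ?_) ((hc y).intervalIntegrable _ _)
  rw [min_eq_left hbc] at hr
  exact (h.hasDerivWithinAt hσ hT z (hb.trans hr.1.le)).mono Ioi_subset_Ici_self

theorem hasDerivAt_extendZero {f : C(disc, ℂ)} (hf : f ∈ Hol disc) (z : disc) :
    HasDerivAt (extendZero disc f) (holDeriv f z) z :=
  (DifferentiableOn.differentiableAt hf (disc.isOpen.mem_nhds z.2)).hasDerivAt

variable {T : ℝ≥0 → F →ₗ[ℂ] F} {G g : C(disc, ℂ)}

/-- The derivative of an orbit along a characteristic curve. -/
theorem hasDerivWithinAt_characteristic (hF : F ≤ Hol disc) (hσ : σ ≤ coTopology F)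
    (hT : IsStronglyContSemigroup σ T) {w : ℝ → disc} {a : ℝ}
    (hw : IsSolution (extendZero disc G) w a) {f y : F} (h : HasGeneratorValue σ T f y) {s₀ : ℝ}
    (hs₀ : s₀ ∈ Ico 0 a) :
    HasDerivWithinAt (fun s : ℝ => (T (a - s).toNNReal f : C(disc, ℂ)) (w s))
      (holDeriv (T (a - s₀).toNNReal f : C(disc, ℂ)) (w s₀) * G (w s₀) -
        (T (a - s₀).toNNReal y : C(disc, ℂ)) (w s₀)) (Ici s₀) s₀ := by
  set k₀ := (T (a - s₀).toNNReal y : C(disc, ℂ)) (w s₀) with hk₀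
  have hP : HasDerivWithinAt (fun s : ℝ => (T (a - s₀).toNNReal f : C(disc, ℂ)) (w s))
      (holDeriv (T (a - s₀).toNNReal f : C(disc, ℂ)) (w s₀) * G (w s₀)) (Ici s₀) s₀ := by
    have h₁ := (hasDerivAt_extendZero (hF (T (a - s₀).toNNReal f).2) (w s₀))
    have h₂ := hw.deriv s₀ hs₀
    rw [extendZero_apply] at h₂
    have h₃ := h₁.comp_hasDerivWithinAt s₀ h₂
    refine h₃.congr (fun s _ => ?_) ?_ <;> simp [extendZero_apply]
  -- The time increment is taken at the moving point `w s`: it equals minus the integral of `(T r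
  -- y)(w s)` over `[a - s, a - s₀]`, and joint continuity makes the integrand close to `k₀`.
  have hQ : HasDerivWithinAt (fun s : ℝ => (T (a - s).toNNReal f : C(disc, ℂ)) (w s) -
      (T (a - s₀).toNNReal f : C(disc, ℂ)) (w s)) (-k₀) (Ici s₀) s₀ := by
    rw [hasDerivWithinAt_iff_isLittleO, Asymptotics.isLittleO_iff]
    intro ε hε
    have hcont : Continuous fun q : ℝ × ℝ => (T q.1.toNNReal y : C(disc, ℂ)) (w q.2) :=
      (hT.continuous_eval hσ y).comp
        ((continuous_real_toNNReal.comp continuous_fst).prodMk (hw.cont.comp continuous_snd))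
    obtain ⟨δ, hδ, hball⟩ := Metric.mem_nhds_iff.1
      (hcont.tendsto (a - s₀, s₀) (Metric.closedBall_mem_nhds _ hε))
    have hev : ∀ᶠ s in 𝓝[≥] s₀, s < min a (s₀ + δ) :=
      nhdsWithin_le_nhds (Iio_mem_nhds (lt_min hs₀.2 (by linarith)))
    filter_upwards [hev, self_mem_nhdsWithin] with s hs hs'
    have hs' : s₀ ≤ s := hs'
    rw [lt_min_iff] at hs
    have hint := h.integral_eq hσ hT (w s) (b := a - s) (c := a - s₀) (by linarith) (by linarith)
    have hcs : IntervalIntegrable (fun r : ℝ => (T r.toNNReal y : C(disc, ℂ)) (w s))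
        MeasureTheory.volume (a - s) (a - s₀) :=
      (hcont.comp (continuous_id.prodMk continuous_const)).intervalIntegrable _ _
    have hb := intervalIntegral.norm_integral_le_of_norm_le_const (a := a - s) (b := a - s₀)
      (C := ε) (f := fun r : ℝ => (T r.toNNReal y : C(disc, ℂ)) (w s) - k₀) fun r hr => by
        rw [uIoc_of_le (by linarith)] at hr
        have : (r, s) ∈ Metric.ball (a - s₀, s₀) δ := by
          rw [Metric.mem_ball, Prod.dist_eq, max_lt_iff, Real.dist_eq, Real.dist_eq, abs_lt, abs_lt]
          exact ⟨⟨by linarith [hr.1], by linarith [hr.2]⟩, by linarith, by linarith⟩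
        have := hball this
        rwa [mem_preimage, Metric.mem_closedBall, dist_eq_norm] at this
    rw [intervalIntegral.integral_sub hcs (by simp), hint, intervalIntegral.integral_const] at hb
    have e : a - s₀ - (a - s) = s - s₀ := by ring
    rw [e] at hb
    rw [← norm_neg, Real.norm_eq_abs]
    refine le_of_eq_of_le (congrArg norm ?_) hb
    rw [smul_neg]
    abel
  have := hP.add hQ
  refine (this.congr_deriv (by ring)).congr (fun s _ => ?_) ?_ <;> simp

/-- The transport terms `G u_z` cancel along the characteristic, and the exponential is the
integrating factor for `g u`; the product has right derivative zero. -/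
theorem apply_eq_of_hasGeneratorValue (hF : F ≤ Hol disc) (hσ : σ ≤ coTopology F)
    (hT : IsStronglyContSemigroup σ T)
    (hval : ∀ f h : F, HasGeneratorValue σ T f h → ∀ z : disc, (h : C(disc, ℂ)) z =
      G z * holDeriv (f : C(disc, ℂ)) z + g z * (f : C(disc, ℂ)) z)
    {w : ℝ → disc} {a : ℝ} (ha : 0 ≤ a) (hw : IsSolution (extendZero disc G) w a) {f y : F}
    (h : HasGeneratorValue σ T f y) :
    (T a.toNNReal f : C(disc, ℂ)) (w 0) =
      Complex.exp (∫ τ in (0 : ℝ)..a, g (w τ)) * (f : C(disc, ℂ)) (w a) := by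
  have hgw : Continuous fun τ => g (w τ) := g.continuous.comp hw.cont
  have hI : ∀ s : ℝ, HasDerivAt (fun s : ℝ => ∫ τ in (0 : ℝ)..s, g (w τ)) (g (w s)) s := fun s =>
    (hgw.integral_hasStrictDerivAt 0 s).hasDerivAt
  have hE : Continuous fun s : ℝ => (T (a - s).toNNReal f : C(disc, ℂ)) (w s) :=
    (hT.continuous_eval hσ f).comp ((by fun_prop : Continuous fun s : ℝ =>
      (a - s).toNNReal).prodMk hw.cont)
  have hIc : Continuous fun s : ℝ => ∫ τ in (0 : ℝ)..s, g (w τ) :=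
    continuous_iff_continuousAt.2 fun s => (hI s).continuousAt
  have := constant_of_has_deriv_right_zero (a := 0) (b := a)
    (f := fun s : ℝ => Complex.exp (∫ τ in (0 : ℝ)..s, g (w τ)) *
      (T (a - s).toNNReal f : C(disc, ℂ)) (w s)) (hIc.cexp.mul hE).continuousOn
    (fun s hs => by
      have h₁ := (hI s).cexp.hasDerivWithinAt (s := Ici s)
      have h₂ := h₁.mul (hasDerivWithinAt_characteristic hF hσ hT hw h hs)
      refine h₂.congr_deriv ?_
      rw [hval _ _ (h.apply hT (a - s).toNNReal) (w s)]
      ring) a ⟨ha, le_rfl⟩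
  simpa [hT.zero] using this.symm

/-- Along characteristic curves the semigroup acts as a weighted composition. -/
theorem apply_eq_of_isSolution (hF : F ≤ Hol disc) (hσ : σ ≤ coTopology F)
    (hT : IsStronglyContSemigroup σ T)
    (hdense : ∀ f : F, ∃ M : ℝ≥0 → F, (∀ t > 0, M t ∈ generatorDomain σ T) ∧
      Tendsto M (𝓝[>] 0) (@nhds F σ f))
    (hval : ∀ f h : F, HasGeneratorValue σ T f h → ∀ z : disc, (h : C(disc, ℂ)) z =
      G z * holDeriv (f : C(disc, ℂ)) z + g z * (f : C(disc, ℂ)) z)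
    {w : ℝ → disc} {a : ℝ} (ha : 0 ≤ a) (hw : IsSolution (extendZero disc G) w a) (f : F) :
    (T a.toNNReal f : C(disc, ℂ)) (w 0) =
      Complex.exp (∫ τ in (0 : ℝ)..a, g (w τ)) * (f : C(disc, ℂ)) (w a) := by
  obtain ⟨M, hM, hMf⟩ := hdense f
  have h₁ := tendsto_eval hσ
    ((@Continuous.tendsto F F σ σ _ (hT.cont a.toNNReal) f).comp hMf) (w 0)
  have h₂ := (tendsto_eval hσ hMf (w a)).const_mul (Complex.exp (∫ τ in (0 : ℝ)..a, g (w τ)))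
  refine tendsto_nhds_unique h₁ (h₂.congr' ?_)
  filter_upwards [self_mem_nhdsWithin] with t ht
  obtain ⟨y, hy⟩ := hM t ht
  exact (apply_eq_of_hasGeneratorValue hF hσ hT hval ha hw hy).symm

end Characteristics

/-! ### Global characteristics and the co-semiflow. -/

section Main

theorem GermsEmbedContinuously.exists_mem {F : Submodule ℂ C(disc, ℂ)} {p : Seminorm ℂ F}
    (h : GermsEmbedContinuously F p) {ω : Opens ℂ} (hω : closedDisc ⊆ ω) {f : ℂ → ℂ}
    (hf : DifferentiableOn ℂ f ω) : ∃ k : F, ∀ z : disc, (k : C(disc, ℂ)) z = f z := by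
  obtain ⟨J, hJ, -⟩ := h
  exact ⟨J ⟨f, ω, hω, f, hf, rfl⟩, hJ _ f rfl⟩

theorem GermsEmbedContinuously.exists_mem_resolvent {F : Submodule ℂ C(disc, ℂ)}
    {p : Seminorm ℂ F} (h : GermsEmbedContinuously F p) {a : ℂ} (ha : 1 < ‖a‖) :
    ∃ k : F, ∀ z : disc, (k : C(disc, ℂ)) z = (a - z)⁻¹ := by
  refine h.exists_mem (ω := ⟨{a}ᶜ, isOpen_compl_singleton⟩) (f := fun z => (a - z)⁻¹) ?_ ?_
  · rintro z hz rfl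
    exact ha.not_ge (mem_closedBall_zero_iff.1 hz)
  · exact fun z hz => ((differentiableAt_id.const_sub a).inv
      (sub_ne_zero.2 fun e => hz e.symm)).differentiableWithinAt

/-- A continuous right derivative forces `c` to be a primitive of it, which upgrades one-sided
derivatives to `C¹`. -/
theorem contDiffOn_and_hasDerivWithinAt_of_right {c c' : ℝ → ℂ} (hc : Continuous c)
    (hc' : Continuous c') (h : ∀ τ ≥ 0, HasDerivWithinAt c (c' τ) (Ici τ) τ) :
    ContDiffOn ℝ 1 c (Ici 0) ∧ ∀ τ ≥ 0, HasDerivWithinAt c (c' τ) (Ici 0) τ := by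
  have heq : ∀ s ∈ Ici (0 : ℝ), c s = c 0 + ∫ τ in (0 : ℝ)..s, c' τ := by
    intro s hs
    have := intervalIntegral.integral_eq_sub_of_hasDeriv_right (a := 0) (b := s)
      hc.continuousOn (fun τ hτ => (h τ ?_).mono Ioi_subset_Ici_self)
      (hc'.intervalIntegrable _ _)
    · rw [this]
      ring
    · rw [min_eq_left hs] at hτ
      exact hτ.1.le
  have hd : ∀ s, HasDerivAt (fun s : ℝ => c 0 + ∫ τ in (0 : ℝ)..s, c' τ) (c' s) s := fun s =>
    ((hc'.integral_hasStrictDerivAt 0 s).hasDerivAt).const_add _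
  refine ⟨ContDiffOn.congr (ContDiff.contDiffOn (contDiff_one_iff_deriv.2
    ⟨fun s => (hd s).differentiableAt, ?_⟩)) heq, fun τ hτ =>
    (hd τ).hasDerivWithinAt.congr heq (heq τ hτ)⟩
  have : deriv (fun s : ℝ => c 0 + ∫ τ in (0 : ℝ)..s, c' τ) = c' := funext fun s => (hd s).deriv
  rwa [this]

variable {F : Submodule ℂ C(disc, ℂ)} {T : ℝ≥0 → F →ₗ[ℂ] F} {G g : C(disc, ℂ)}

/-- A semigroup on `F` that acts as a weighted composition along the characteristic curves of `G`
forces all these curves to exist for all times. -/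
theorem exists_isSolution_of_apply_eq (hF : F ≤ Hol disc) (hG : G ∈ Hol disc)
    {one ident : F} (hone : ∀ z : disc, (one : C(disc, ℂ)) z = 1)
    (hident : ∀ z : disc, (ident : C(disc, ℂ)) z = z)
    (hres : ∀ a : ℂ, 1 < ‖a‖ → ∃ k : F, ∀ z : disc, (k : C(disc, ℂ)) z = (a - z)⁻¹)
    (happly : ∀ (w : ℝ → disc) (a : ℝ), 0 ≤ a → IsSolution (extendZero disc G) w a → ∀ f : F,
      (T a.toNNReal f : C(disc, ℂ)) (w 0) =
        Complex.exp (∫ τ in (0 : ℝ)..a, g (w τ)) * (f : C(disc, ℂ)) (w a))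
    (a : ℝ) (x : disc) : ∃ w : ℝ → disc, w 0 = x ∧ IsSolution (extendZero disc G) w a := by
  have hG' : DifferentiableOn ℂ (extendZero disc G) (Metric.ball 0 1) := hG
  obtain ⟨ε, hε, hloc⟩ := exists_isSolution hG' (R := 1 / 2) (by norm_num)
  refine exists_isSolution_of_uniform hε (fun x => ?_) a x
  let o : disc := ⟨0, Metric.mem_ball_self one_pos⟩
  obtain ⟨w₀, hw₀, hw₀s⟩ := hloc o (by simp [o])
  obtain ⟨s₁, hs₁, hmax⟩ := (isCompact_Icc (a := 0) (b := ε)).exists_isMaxOn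
    (nonempty_Icc.2 hε.le) (f := fun s => ‖(w₀ s : ℂ)‖)
    (continuous_norm.comp (continuous_subtype_val.comp hw₀s.cont)).continuousOn
  have hlt : ∀ z : disc, ‖(z : ℂ)‖ < 1 := fun z => mem_ball_zero_iff.1 z.2
  -- The solution from 0 stays within this radius throughout `[0, ε]`, which makes the later bound
  -- independent of `s`.
  set ρ := ‖(w₀ s₁ : ℂ)‖ with hρdef
  have hρ : ρ < 1 := hlt _
  have hx2 : 0 < 1 - ‖(x : ℂ)‖ ^ 2 := by
    have := pow_lt_one₀ (norm_nonneg _) (hlt x) two_ne_zero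
    linarith
  have hR : √(1 - (1 - ρ) ^ 2 * (1 - ‖(x : ℂ)‖ ^ 2)) < 1 := by
    rw [Real.sqrt_lt' one_pos]
    have := mul_pos (pow_pos (sub_pos.2 hρ) 2) hx2
    linarith
  refine exists_isSolution_of_bound hG' hε.le hR fun s hs w hw0 hw => ?_
  let S : F → ℂ → ℂ := fun f => extendZero disc (T s.toNNReal f : C(disc, ℂ))
  have hS : ∀ f, DifferentiableOn ℂ (S f) (Metric.ball 0 1) := fun f => hF (T s.toNNReal f).2
  have hSw : ∀ v : ℝ → disc, IsSolution (extendZero disc G) v s → ∃ e : ℂ, e ≠ 0 ∧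
      ∀ f : F, S f (v 0) = e * (f : C(disc, ℂ)) (v s) := fun v hv =>
    ⟨_, Complex.exp_ne_zero _, fun f => (extendZero_apply _ _).trans (happly v s hs.1 hv f)⟩
  obtain ⟨e₀, he₀, h₀⟩ := hSw w₀ (hw₀s.mono hs.2)
  rw [hw₀] at h₀
  have hm0 : S one 0 = e₀ := by simpa [hone] using h₀ one
  have hq0 : S ident 0 = e₀ * w₀ s := by simpa [hident] using h₀ ident
  obtain ⟨e, he, hwe⟩ := hSw w hw
  rw [hw0] at hwe
  -- At `z` no solution is known to survive until `s`, so the claim is carried there by analytic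
  -- continuation of an identity valid near 0.
  have hdiv : ∀ z ∈ Metric.ball (0 : ℂ) 1, ∀ b : ℂ, 1 < ‖b‖ → b * S one z = S ident z →
      S one z = 0 := by
    intro z hz b hb hbz
    obtain ⟨k, hk⟩ := hres b hb
    -- With `v` the solution from `y` and `d` its weight, this reads `d/(b - v(s)) · d(b - v(s)) =
    -- d²`.
    have hloc' : (fun y => S k y * (b * S one y - S ident y)) =ᶠ[𝓝 0] fun y => S one y ^ 2 := by
      filter_upwards [Metric.ball_mem_nhds (0 : ℂ) (by norm_num : (0 : ℝ) < 1 / 2)] with y hy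
      have hy' := mem_ball_zero_iff.1 hy
      obtain ⟨v, hv0, hv⟩ := hloc ⟨y, mem_ball_zero_iff.2 (by linarith)⟩ hy'.le
      obtain ⟨d, -, hd⟩ := hSw v (hv.mono hs.2)
      simp only [hv0] at hd
      have hne : b - v s ≠ 0 := by
        refine sub_ne_zero.2 fun h => ?_
        rw [h] at hb
        exact hb.not_gt (hlt _)
      simp only [hd, hk, hone, hident]
      field_simp
    have han : ∀ {f : ℂ → ℂ}, DifferentiableOn ℂ f (Metric.ball 0 1) →
        AnalyticOnNhd ℂ f (Metric.ball 0 1) := fun hf => hf.analyticOnNhd Metric.isOpen_ball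
    have := (han ((hS k).mul (((hS one).const_mul b).sub
      (hS ident)))).eqOn_of_preconnected_of_eventuallyEq
      (han ((hS one).pow 2)) (convex_ball 0 1).isPreconnected (Metric.mem_ball_self one_pos)
      hloc' hz
    simp only [Pi.mul_apply, Pi.sub_apply, Pi.pow_apply, hbz, sub_self, mul_zero] at this
    exact pow_eq_zero_iff two_ne_zero |>.1 this.symm
  have := norm_le_mul_norm_of_quotient (hS one) (hS ident) (hm0 ▸ he₀) hdiv hρ (by
    rw [hq0, hm0, norm_mul, mul_comm]
    exact mul_le_mul_of_nonneg_right (hmax hs) (norm_nonneg _)) x.2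
  rw [hwe, hwe, hone, hident, mul_one, norm_mul, mul_comm] at this
  exact le_of_mul_le_mul_right this (norm_pos_iff.2 he)

/-- A strongly continuous semigroup that acts as a weighted composition along the characteristic
curves of `G`, which are assumed to exist for all times, is a weighted composition semigroup. -/
theorem exists_coSemiflow (hF : F ≤ Hol disc) {σ : TopologicalSpace F} (hσ : σ ≤ coTopology F)
    (hT : IsStronglyContSemigroup σ T)
    {one ident : F} (hone : ∀ z : disc, (one : C(disc, ℂ)) z = 1)
    (hident : ∀ z : disc, (ident : C(disc, ℂ)) z = z)
    (happly : ∀ (w : ℝ → disc) (a : ℝ), 0 ≤ a → IsSolution (extendZero disc G) w a → ∀ f : F,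
      (T a.toNNReal f : C(disc, ℂ)) (w 0) =
        Complex.exp (∫ τ in (0 : ℝ)..a, g (w τ)) * (f : C(disc, ℂ)) (w a))
    (hsol : ∀ (a : ℝ) (x : disc), ∃ w : ℝ → disc, w 0 = x ∧ IsSolution (extendZero disc G) w a) :
    ∃ (m : ℝ≥0 → disc → ℂ) (φ : ℝ≥0 → disc → disc),
      IsJointlyContHolCoSemiflow m φ ∧ IsCoSemiflowFor F m φ ∧ IsFlowGenerator φ G ∧
      (∀ (t : ℝ≥0) (z : disc), m t z =
        Complex.exp (∫ s in (0 : ℝ)..(t : ℝ), g (φ s.toNNReal z))) ∧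
      ∀ (t : ℝ≥0) (f : F) (z : disc),
        (T t f : C(disc, ℂ)) z = m t z * (f : C(disc, ℂ)) (φ t z) := by
  choose W hW0 hW using hsol
  let m : ℝ≥0 → disc → ℂ := fun t z => (T t one : C(disc, ℂ)) z
  let φ : ℝ≥0 → disc → disc := fun t z => W t z t
  have hcurve : ∀ (t : ℝ≥0) (w : ℝ → disc) (a : ℝ), t ≤ a → IsSolution (extendZero disc G) w a →
      m t (w 0) = Complex.exp (∫ τ in (0 : ℝ)..t, g (w τ)) ∧
      (T t ident : C(disc, ℂ)) (w 0) = m t (w 0) * w t ∧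
      ∀ f : F, (T t f : C(disc, ℂ)) (w 0) = m t (w 0) * (f : C(disc, ℂ)) (w t) := by
    intro t w a hta hw
    have h := happly w t t.coe_nonneg (hw.mono hta)
    simp only [Real.toNNReal_coe] at h
    have h₁ : m t (w 0) = Complex.exp (∫ τ in (0 : ℝ)..t, g (w τ)) := by
      simp only [m, h, hone, mul_one]
    refine ⟨h₁, ?_, fun f => ?_⟩
    · rw [h₁, h, hident]
    · rw [h₁, h]
  have hm0 : ∀ t z, m t z ≠ 0 := by
    intro t z
    have := (hcurve t (W t z) t le_rfl (hW _ _)).1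
    rw [hW0] at this
    rw [this]
    exact Complex.exp_ne_zero _
  -- This expresses the flow through the semigroup alone. It yields uniqueness of solutions, joint
  -- continuity, holomorphy and the flow law.
  have hφ : ∀ t z, (φ t z : ℂ) = (T t ident : C(disc, ℂ)) z / m t z := by
    intro t z
    have := (hcurve t (W t z) t le_rfl (hW _ _)).2.1
    rw [hW0] at this
    rw [this, mul_div_cancel_left₀ _ (hm0 t z)]
  have huniq : ∀ (t : ℝ≥0) (w : ℝ → disc) (a : ℝ), t ≤ a → IsSolution (extendZero disc G) w a →
      φ t (w 0) = w t := by
    intro t w a hta hw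
    apply Subtype.ext
    rw [hφ, (hcurve t w a hta hw).2.1, mul_div_cancel_left₀ _ (hm0 _ _)]
  have hTf : ∀ (t : ℝ≥0) (f : F) (z : disc),
      (T t f : C(disc, ℂ)) z = m t z * (f : C(disc, ℂ)) (φ t z) := by
    intro t f z
    have := (hcurve t (W t z) t le_rfl (hW _ _)).2.2 f
    rwa [hW0] at this
  have hadd : ∀ (t s : ℝ≥0) (f : F) (z : disc),
      (T (t + s) f : C(disc, ℂ)) z = m t z * (T s f : C(disc, ℂ)) (φ t z) := by
    intro t s f z
    rw [hT.add, LinearMap.comp_apply, hTf]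
  have hjm : Continuous fun q : ℝ≥0 × disc => m q.1 q.2 := hT.continuous_eval hσ one
  have hjφ : Continuous fun q : ℝ≥0 × disc => φ q.1 q.2 := by
    refine Continuous.subtype_mk (f := fun q : ℝ≥0 × disc => (φ q.1 q.2 : ℂ)) ?_
      fun q => (φ q.1 q.2).2
    simp only [hφ]
    exact (hT.continuous_eval hσ ident).div hjm fun q => hm0 _ _
  have hφ0 : ∀ z, φ 0 z = z := by
    intro z
    have := hW0 ((0 : ℝ≥0) : ℝ) z
    simpa [φ] using this
  have hflow : ∀ (s : ℝ) (z : disc), 0 ≤ s → ∀ a, s ≤ a → φ s.toNNReal z = W a z s := by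
    intro s z hs a hsa
    have := huniq s.toNNReal (W a z) a (by rwa [Real.coe_toNNReal _ hs]) (hW _ _)
    rwa [hW0, Real.coe_toNNReal _ hs] at this
  have horbit : ∀ z, Continuous fun s : ℝ => φ s.toNNReal z := fun z =>
    hjφ.comp (continuous_real_toNNReal.prodMk continuous_const)
  have hright : ∀ z, ∀ τ ≥ (0 : ℝ), HasDerivWithinAt (fun s : ℝ => (φ s.toNNReal z : ℂ))
      (G (φ τ.toNNReal z)) (Ici τ) τ := by
    intro z τ hτ
    have h₁ := (hW (τ + 1) z).deriv τ ⟨hτ, by linarith⟩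
    rw [extendZero_apply, ← hflow τ z hτ _ (by linarith)] at h₁
    refine h₁.congr_of_eventuallyEq ?_
      (congrArg Subtype.val (hflow τ z hτ _ (by linarith)))
    filter_upwards [self_mem_nhdsWithin,
      nhdsWithin_le_nhds (Iio_mem_nhds (lt_add_one τ))] with s hs hs'
    rw [hflow s z (hτ.le.trans hs) _ (mem_Iio.1 hs').le]
  have hgen := fun z => contDiffOn_and_hasDerivWithinAt_of_right
    (continuous_subtype_val.comp (horbit z)) (G.continuous.comp (horbit z)) (hright z)
  refine ⟨m, φ, ⟨⟨?_, hφ0, ?_⟩, ⟨?_, ?_, ?_⟩, hjφ, hjm, ?_, fun t => hF (T t one).2⟩,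
    fun t f => ⟨T t f, hTf t f⟩, ⟨G.continuous, fun z => (hgen z).1, ?_⟩, ?_, hTf⟩
  · exact fun t => hjφ.comp (continuous_const.prodMk continuous_id)
  · intro t s z
    apply Subtype.ext
    rw [hφ, hφ, add_comm t s, hadd]
    change _ / (T (s + t) one : C(disc, ℂ)) z = _
    rw [hadd, mul_div_mul_left _ _ (hm0 s z)]
  · exact fun t => hjm.comp (continuous_const.prodMk continuous_id)
  · intro z
    simp [m, hT.zero, hone]
  · exact fun t s z => hadd t s one z
  · intro t
    have h₁ : DifferentiableOn ℂ (extendZero disc (T t ident : C(disc, ℂ))) disc :=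
      hF (T t ident).2
    have h₂ : DifferentiableOn ℂ (extendZero disc (m t)) disc := hF (T t one).2
    refine (h₁.div h₂ fun z hz => ?_).congr fun z hz => ?_
    · exact (extendZero_apply (m t) ⟨z, hz⟩).trans_ne (hm0 _ _)
    · have h₃ := extendZero_apply (fun z => (φ t z : ℂ)) ⟨z, hz⟩
      have h₄ := extendZero_apply (U := disc) (T t ident : C(disc, ℂ)) ⟨z, hz⟩
      have h₅ := extendZero_apply (m t) ⟨z, hz⟩
      simp only at h₃ h₄ h₅
      rw [h₃, Pi.div_apply, h₄, h₅, hφ]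
  · intro t z
    have := (hgen z).2 t t.coe_nonneg
    simpa [Function.comp_def] using this
  · intro t z
    have := (hcurve t (W t z) t le_rfl (hW _ _)).1
    rw [hW0] at this
    rw [this]
    congr 1
    refine intervalIntegral.integral_congr fun s hs => ?_
    rw [uIcc_of_le t.coe_nonneg] at hs
    simp only [hflow s z hs.1 t hs.2]

end Main

end Saks

end

theorem mainTheorem7
    (F : Submodule ℂ C(Saks.disc, ℂ)) (hF : F ≤ Saks.Hol Saks.disc)
    (p : Seminorm ℂ F)
    (hSaks : Saks.IsPreSaks p (Saks.coTopology F))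
    (hcomplete : Saks.IsSeqComplete (Saks.gammaTopology F p))
    (hgerms : Saks.GermsEmbedContinuously F p)
    (T : ℝ≥0 → F →ₗ[ℂ] F) (hT : Saks.IsStronglyContSemigroup (Saks.gammaTopology F p) T)
    (G g : Saks.Hol Saks.disc)
    (hdom : Saks.generatorDomain (Saks.gammaTopology F p) T =
      {f : F | ∃ h : F, ∀ z : Saks.disc, (h : C(Saks.disc, ℂ)) z =
        (G : C(Saks.disc, ℂ)) z * Saks.holDeriv (f : C(Saks.disc, ℂ)) z +
          (g : C(Saks.disc, ℂ)) z * (f : C(Saks.disc, ℂ)) z})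
    (hval : ∀ f h : F, Saks.HasGeneratorValue (Saks.gammaTopology F p) T f h →
      ∀ z : Saks.disc, (h : C(Saks.disc, ℂ)) z =
        (G : C(Saks.disc, ℂ)) z * Saks.holDeriv (f : C(Saks.disc, ℂ)) z +
          (g : C(Saks.disc, ℂ)) z * (f : C(Saks.disc, ℂ)) z) :
    ∃ (m : ℝ≥0 → Saks.disc → ℂ) (φ : ℝ≥0 → Saks.disc → Saks.disc),
      Saks.IsJointlyContHolCoSemiflow m φ ∧
      Saks.IsCoSemiflowFor F m φ ∧
      Saks.IsFlowGenerator φ (G : C(Saks.disc, ℂ)) ∧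
      (∀ (t : ℝ≥0) (z : Saks.disc), m t z =
        Complex.exp (∫ s in (0 : ℝ)..(t : ℝ), (g : C(Saks.disc, ℂ)) (φ s.toNNReal z))) ∧
      ∀ (t : ℝ≥0) (f : F) (z : Saks.disc),
        (T t f : C(Saks.disc, ℂ)) z = m t z * (f : C(Saks.disc, ℂ)) (φ t z) := by
  have hmix := hSaks.isMixing_mixedTopology
  have hσ := hmix.finer
  let ev : Saks.disc → F →ₗ[ℂ] ℂ := fun z =>
    { toFun := fun f => (f : C(Saks.disc, ℂ)) z
      map_add' := fun _ _ => rfl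
      map_smul' := fun _ _ => rfl }
  have hev : ∀ z, @Continuous F ℂ (Saks.gammaTopology F p) _ (ev z) := fun z =>
    continuous_le_dom hσ (@Continuous.comp _ _ _ (Saks.coTopology F) _ _ Subtype.val
      (fun f : C(Saks.disc, ℂ) => f z) (continuous_eval_const z) continuous_induced_dom)
  have hsep : ∀ x y : F, (∀ z, ev z x = ev z y) → x = y := fun x y hxy =>
    Subtype.ext (ContinuousMap.ext hxy)
  have hdense := @Saks.exists_tendsto_mem_generatorDomain F _ _ (Saks.gammaTopology F p)
    hmix.addGroup hmix.smul (fun W hW => hSaks.exists_convex_nhds hW) hcomplete T hT Saks.disc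
    ev hev hsep
  obtain ⟨one, hone⟩ := hgerms.exists_mem (ω := ⊤) (subset_univ _) (f := fun _ => 1)
    (differentiableOn_const 1)
  obtain ⟨ident, hident⟩ := hgerms.exists_mem (ω := ⊤) (subset_univ _) (f := fun z => z)
    differentiableOn_id
  have happly := fun (w : ℝ → Saks.disc) (a : ℝ) (ha : 0 ≤ a)
    (hw : Saks.IsSolution (Saks.extendZero Saks.disc (G : C(Saks.disc, ℂ))) w a) (f : F) =>
    Saks.apply_eq_of_isSolution hF hσ hT hdense hval ha hw f
  exact Saks.exists_coSemiflow hF hσ hT hone hident happly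
    (Saks.exists_isSolution_of_apply_eq hF G.2 hone hident
      (fun _ ha => hgerms.exists_mem_resolvent ha) happly)
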